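/- Let $M$ be a closed (compact, without boundary) connected smooth manifold which carries a closed $1$-form that is not exact (that is, $H^1(M;\mathbb{R})\neq 0$); all forms, vector fields and Riemannian metrics below are smooth. A closed $1$-form $\omega$ on $M$ induces the homomorphism $\xi_\omega:\pi_1(M)\to\mathbb{R}$, $\xi_\omega(g)=\int_\gamma\omega$, where $\gamma$ is a smooth loop representing $g$; $\omega$ is called *rational* if the image of $\xi_\omega$ is infinite cyclic. A closed $1$-form $\omega$ is a *Morse form* if it is locally the differential of real valued functions whose critical points are nondegenerate; its critical points are the points $p$ with $\omega_p=0$. A vector field $v$ is an *$\omega$-gradient* if there is a Riemannian metric $g$ on $M$ with $\omega_x(X)=g(X,v(x))$ for all $x\in M$ and $X\in T_xM$. **Lemma.** For every Morse form $\omega$ on $M$ and every $\omega$-gradient $v$ there exists a rational Morse form $\omega'$ on $M$ which has the same set of critical points as $\omega$ and agrees with $\omega$ in a neighborhood of this set, such that $v$ is also an $\omega'$-gradient. -/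

import Mathlib

open scoped Manifold ContDiff Bundle

noncomputable section

namespace MorseForms

variable {n : ℕ} {M : Type*} [TopologicalSpace M] [ChartedSpace (EuclideanSpace ℝ (Fin n)) M]
  [IsManifold (𝓡 n) ∞ M]

/-- Smooth (that is, `C^∞`) 1-forms on the `n`-manifold `M`: smooth sections of the cotangent
bundle. -/
abbrev OneForm (n : ℕ) (M : Type*) [TopologicalSpace M]
    [ChartedSpace (EuclideanSpace ℝ (Fin n)) M] [IsManifold (𝓡 n) ∞ M] :=
  ContMDiffSection (𝓡 n) (EuclideanSpace ℝ (Fin n) →L[ℝ] ℝ) ∞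
    (fun x : M => TangentSpace (𝓡 n) x →L[ℝ] Bundle.Trivial M ℝ x)

/-- Smooth vector fields on the `n`-manifold `M`: smooth sections of the tangent bundle. -/
abbrev SmoothVectorField (n : ℕ) (M : Type*) [TopologicalSpace M]
    [ChartedSpace (EuclideanSpace ℝ (Fin n)) M] [IsManifold (𝓡 n) ∞ M] :=
  ContMDiffSection (𝓡 n) (EuclideanSpace ℝ (Fin n)) ∞ (TangentSpace (𝓡 n) : M → Type)

/-- Smooth Riemannian metrics on the `n`-manifold `M`. -/
abbrev RiemannianMetric (n : ℕ) (M : Type*) [TopologicalSpace M]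
    [ChartedSpace (EuclideanSpace ℝ (Fin n)) M] [IsManifold (𝓡 n) ∞ M] :=
  Bundle.ContMDiffRiemannianMetric (𝓡 n) ∞ (EuclideanSpace ℝ (Fin n))
    (fun x : M => TangentSpace (𝓡 n) x)

/-- The pullback of `θ` under the inverse of the chart around `p`, as a 1-form on (the target of
the chart in) Euclidean space. -/
def inChart (θ : OneForm n M) (p : M) (y : EuclideanSpace ℝ (Fin n)) :
    EuclideanSpace ℝ (Fin n) →L[ℝ] ℝ :=
  (θ ((extChartAt (𝓡 n) p).symm y)).comp
    (mfderiv 𝓘(ℝ, EuclideanSpace ℝ (Fin n)) (𝓡 n) (extChartAt (𝓡 n) p).symm y)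

/-- `dθ = 0`: in the charts, `dθ(u, w) = D_u θ(w) - D_w θ(u)` vanishes. -/
def IsClosedForm (θ : OneForm n M) : Prop :=
  ∀ p : M, ∀ y ∈ (extChartAt (𝓡 n) p).target, ∀ u w : EuclideanSpace ℝ (Fin n),
    fderiv ℝ (inChart θ p) y u w = fderiv ℝ (inChart θ p) y w u

/-- `θ = df` for some smooth function `f : M → ℝ`. -/
def IsExactForm (θ : OneForm n M) : Prop :=
  ∃ f : M → ℝ, ContMDiff (𝓡 n) 𝓘(ℝ, ℝ) ∞ f ∧ ∀ x, θ x = mvfderiv (𝓡 n) f x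

/-- The critical points of `θ` are its zeros. -/
def criticalSet (θ : OneForm n M) : Set M := {x | θ x = 0}

/-- The Hessian of `f` at `p`, computed in the chart around `p`, is a nondegenerate bilinear form.
(At a critical point `p` of `f` this does not depend on the chart.) -/
def HasNondegenerateHessianAt (f : M → ℝ) (p : M) : Prop :=
  ∀ u : EuclideanSpace ℝ (Fin n),
    (∀ w : EuclideanSpace ℝ (Fin n),
      fderiv ℝ (fderiv ℝ (f ∘ (extChartAt (𝓡 n) p).symm)) (extChartAt (𝓡 n) p p) u w = 0) → u = 0

/-- A Morse form is a closed 1-form that is locally the differential of real valued functions all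
of whose critical points are nondegenerate. -/
def IsMorseForm (θ : OneForm n M) : Prop :=
  IsClosedForm θ ∧
    ∀ x : M, ∃ U : Set M, IsOpen U ∧ x ∈ U ∧ ∃ f : M → ℝ,
      ContMDiffOn (𝓡 n) 𝓘(ℝ, ℝ) ∞ f U ∧ (∀ y ∈ U, θ y = mvfderiv (𝓡 n) f y) ∧
      ∀ y ∈ U, mvfderiv (𝓡 n) f y = 0 → HasNondegenerateHessianAt (n := n) f y

/-- `v` is an `θ`-gradient: it is dual to `θ` with respect to some Riemannian metric. -/
def IsGradient (θ : OneForm n M) (v : SmoothVectorField n M) : Prop :=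
  ∃ g : RiemannianMetric n M, ∀ (x : M) (X : TangentSpace (𝓡 n) x), θ x X = g.inner x X (v x)

/-- The path `γ : [0, 1] → M` is smooth. -/
def IsSmoothPath (n : ℕ) {M : Type*} [TopologicalSpace M]
    [ChartedSpace (EuclideanSpace ℝ (Fin n)) M] {x y : M} (γ : Path x y) : Prop :=
  ContMDiffOn 𝓘(ℝ, ℝ) (𝓡 n) ∞ γ.extend (Set.Icc 0 1)

/-- The line integral of `θ` along `γ`, for a smooth path `γ`. -/
def lineIntegral (θ : OneForm n M) {x y : M} (γ : Path x y) : ℝ :=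
  ∫ t in (0 : ℝ)..1, θ (γ.extend t)
    (mfderivWithin 𝓘(ℝ, ℝ) (𝓡 n) γ.extend (Set.Icc 0 1) t (1 : ℝ))

/-- `c` is the value at `g ∈ π₁(M, x₀)` of the homomorphism `ξ_θ : π₁(M, x₀) → ℝ` induced by the
closed form `θ`: it is the integral of `θ` along a smooth loop that represents `g`. -/
def IsPeriod (θ : OneForm n M) (x₀ : M) (g : FundamentalGroup M x₀) (c : ℝ) : Prop :=
  ∃ γ : Path x₀ x₀, IsSmoothPath n γ ∧
    FundamentalGroup.fromPath (Path.Homotopic.Quotient.mk γ) = g ∧ lineIntegral θ γ = c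

/-- The image of `ξ_θ : π₁(M, x₀) → ℝ`, as a subgroup of `ℝ`. (The set of all values of `ξ_θ` is
itself a subgroup, as `ξ_θ` is a homomorphism, so that taking the closure adds nothing to it.) -/
def periodGroup (θ : OneForm n M) (x₀ : M) : AddSubgroup ℝ :=
  AddSubgroup.closure {c | ∃ g : FundamentalGroup M x₀, IsPeriod θ x₀ g c}

/-- A closed 1-form is rational if the image of `ξ_θ` is infinite cyclic. -/
def IsRational (θ : OneForm n M) : Prop :=
  IsClosedForm θ ∧ ∀ x₀ : M, Nonempty (periodGroup θ x₀ ≃+ ℤ)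

end MorseForms

end

noncomputable section

namespace MorseForms

open Bundle Set
open scoped Topology

set_option linter.unusedSectionVars false

variable {n : ℕ} {M : Type*} [TopologicalSpace M] [ChartedSpace (EuclideanSpace ℝ (Fin n)) M]
  [IsManifold (𝓡 n) ∞ M]

/-! ### 1-forms in trivializations and their local primitives -/

section

/-! Perturb the class of `θ` to a rational one without touching `θ` near its zeros. By
`exists_integral_family`, `θ` is, up to an exact form, `∑ bᵢ Aᵢ` with finitely many integral forms
`Aᵢ` (logarithmic differentials of circle-valued maps), at least one of which is not exact; the
latter comes from the assumption on `M` and is needed because `θ` itself may be exact. A Morse form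
on a compact manifold has finitely many zeros, so each `Aᵢ` has a global function `Fᵢ` with `dFᵢ =
Aᵢ` near all of them. Put `θ' = θ + ∑ (qᵢ - bᵢ)(Aᵢ - dFᵢ)` with `qᵢ` rational and close to `bᵢ`.

Then `θ' = θ` near the zeros, and `θ'` is cohomologous to `∑ qᵢ Aᵢ`, so its periods lie in `(1/N)ℤ`.
They are not all zero if `q` avoids the proper subspace of coefficients giving exact combinations
(`exists_rat_notMem`), since a closed form without periods is exact. By compactness `θ'(v)` stays
positive off the zeros of `θ` (`exists_pairing_pos`), so no new zeros appear, and an explicit change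
of the metric makes `v` dual to `θ'` (`IsGradient.of_eq_near_criticalSet`).

The integral decomposition needs no finiteness theorem for cohomology. Local primitives on a finite
cover differ by finitely many constants; these generate a free abelian group of finite rank, and
splitting them into integer coordinates gives integral cocycles, which a partition of unity turns
into forms. -/

lemma oneForm_coords (α : ∀ x : M, TangentSpace (𝓡 n) x →L[ℝ] ℝ) (x₀ x : M) :
    ((trivializationAt (EuclideanSpace ℝ (Fin n) →L[ℝ] ℝ)
      (fun x : M => TangentSpace (𝓡 n) x →L[ℝ] Bundle.Trivial M ℝ x) x₀) ⟨x, α x⟩).2 =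
          (α x).comp ((trivializationAt (EuclideanSpace ℝ (Fin n))
        (TangentSpace (𝓡 n) : M → Type) x₀).symmL ℝ x) := by
  rw [hom_trivializationAt_apply]
  ext w
  simp [ContinuousLinearMap.inCoordinates]

lemma contMDiffAt_oneForm_iff {α : ∀ x : M, TangentSpace (𝓡 n) x →L[ℝ] ℝ} {x₀ : M} :
    ContMDiffAt (𝓡 n) ((𝓡 n).prod 𝓘(ℝ, EuclideanSpace ℝ (Fin n) →L[ℝ] ℝ)) ∞
      (fun x => TotalSpace.mk' (EuclideanSpace ℝ (Fin n) →L[ℝ] ℝ)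
        (E := fun x : M => TangentSpace (𝓡 n) x →L[ℝ] Bundle.Trivial M ℝ x) x (α x)) x₀ ↔
    ContMDiffAt (𝓡 n) 𝓘(ℝ, EuclideanSpace ℝ (Fin n) →L[ℝ] ℝ) ∞
      (fun x => (α x).comp ((trivializationAt (EuclideanSpace ℝ (Fin n))
        (TangentSpace (𝓡 n) : M → Type) x₀).symmL ℝ x)) x₀ := by
  rw [contMDiffAt_section]
  simp only [oneForm_coords]

lemma contMDiffAt_mvfderiv {f : M → ℝ} {x₀ : M} (hf : ContMDiffAt (𝓡 n) 𝓘(ℝ, ℝ) ∞ f x₀) :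
    ContMDiffAt (𝓡 n) ((𝓡 n).prod 𝓘(ℝ, EuclideanSpace ℝ (Fin n) →L[ℝ] ℝ)) ∞
      (fun x => TotalSpace.mk' (EuclideanSpace ℝ (Fin n) →L[ℝ] ℝ)
        (E := fun x : M => TangentSpace (𝓡 n) x →L[ℝ] Bundle.Trivial M ℝ x) x
        (mvfderiv (𝓡 n) f x)) x₀ := by
  rw [contMDiffAt_oneForm_iff]
  have := hf.mfderiv_const (m := ∞) (by simp)
  refine this.congr_of_eventuallyEq (Filter.Eventually.of_forall fun x => ?_)
  simp only [inTangentCoordinates, ContinuousLinearMap.inCoordinates]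
  erw [TangentBundle.continuousLinearMapAt_model_space]
  rfl

lemma inChart_extChartAt (θ : OneForm n M) (p : M) {x : M}
    (hx : x ∈ (chartAt (EuclideanSpace ℝ (Fin n)) p).source) :
   inChart θ p (extChartAt (𝓡 n) p x) = (θ x).comp ((trivializationAt (EuclideanSpace ℝ (Fin n))
        (TangentSpace (𝓡 n) : M → Type) p).symmL ℝ x) := by
  rw [TangentBundle.symmL_trivializationAt hx]
  unfold inChart
  rw [(extChartAt (𝓡 n) p).left_inv (by simpa using hx)]
  simp

lemma contDiffOn_inChart (θ : OneForm n M) (p : M) :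
    ContDiffOn ℝ ∞ (inChart θ p) (extChartAt (𝓡 n) p).target := by
  have := (Trivialization.contMDiffOn_section_baseSet_iff (IB := 𝓡 n) (n := ∞)
      (trivializationAt  (EuclideanSpace ℝ (Fin n) →L[ℝ] ℝ)
    (fun x : M => TangentSpace (𝓡 n) x →L[ℝ] Bundle.Trivial M ℝ x) p) (s := θ)).1
        θ.contMDiff.contMDiffOn
  have h2 := this.comp (contMDiffOn_extChartAt_symm p) (by
    intro y hy
    have := (extChartAt (𝓡 n) p).map_target hy
    simpa using this)
  rw [← contMDiffOn_iff_contDiffOn]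
  refine h2.congr fun y hy => ?_
  have hs := (extChartAt (𝓡 n) p).map_target hy
  simp only [Function.comp]
  have := inChart_extChartAt θ p (x := (extChartAt (𝓡 n) p).symm y) (by simpa using hs)
  rw [(extChartAt (𝓡 n) p).right_inv hy] at this
  rw [this]
  exact (oneForm_coords θ p _).symm

/-- Near `x`, the function `f` is smooth and the pointwise 1-form `α` is its differential. -/
def PrimitiveAt (α : ∀ x : M, TangentSpace (𝓡 n) x →L[ℝ] ℝ) (f : M → ℝ) (x : M) : Prop :=
  ∀ᶠ y in 𝓝 x, ContMDiffAt (𝓡 n) 𝓘(ℝ, ℝ) ∞ f y ∧ α y = mvfderiv (𝓡 n) f y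

lemma PrimitiveAt.contMDiffAt {α : ∀ x : M, TangentSpace (𝓡 n) x →L[ℝ] ℝ} {f : M → ℝ} {x : M}
    (h : PrimitiveAt α f x) :
    ContMDiffAt (𝓡 n) ((𝓡 n).prod 𝓘(ℝ, EuclideanSpace ℝ (Fin n) →L[ℝ] ℝ)) ∞
      (fun x => TotalSpace.mk' (EuclideanSpace ℝ (Fin n) →L[ℝ] ℝ)
        (E := fun x : M => TangentSpace (𝓡 n) x →L[ℝ] Bundle.Trivial M ℝ x) x (α x)) x :=
  (contMDiffAt_mvfderiv h.self_of_nhds.1).congr_of_eventuallyEq (h.mono fun y hy => by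
    simp only [hy.2])

/-- A pointwise 1-form with local primitives is smooth. -/
def ofPrimitives (α : ∀ x : M, TangentSpace (𝓡 n) x →L[ℝ] ℝ) (h : ∀ x, ∃ f, PrimitiveAt α f x) :
    OneForm n M :=
  ⟨α, fun x => (h x).choose_spec.contMDiffAt⟩

lemma mdifferentiableAt_of_smooth {f : M → ℝ} {x : M} (h : ContMDiffAt (𝓡 n) 𝓘(ℝ, ℝ) ∞ f x) : MDifferentiableAt (𝓡 n)
    𝓘(ℝ, ℝ) f x :=
  h.mdifferentiableAt (by simp)

section
variable {α β : ∀ x : M, TangentSpace (𝓡 n) x →L[ℝ] ℝ} {f g : M → ℝ} {x : M}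

lemma PrimitiveAt.add (hf : PrimitiveAt α f x) (hg : PrimitiveAt β g x) :
    PrimitiveAt (fun y => α y + β y) (fun y => f y + g y) x := by
  filter_upwards [hf, hg] with y h1 h2
  exact ⟨h1.1.add h2.1, by rw [mvfderiv_fun_add (mdifferentiableAt_of_smooth h1.1) (mdifferentiableAt_of_smooth h2.1), h1.2, h2.2]⟩

lemma PrimitiveAt.sub (hf : PrimitiveAt α f x) (hg : PrimitiveAt β g x) :
    PrimitiveAt (fun y => α y - β y) (fun y => f y - g y) x := by
  filter_upwards [hf, hg] with y h1 h2
  exact ⟨h1.1.sub h2.1, by rw [mvfderiv_fun_sub (mdifferentiableAt_of_smooth h1.1) (mdifferentiableAt_of_smooth h2.1), h1.2, h2.2]⟩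

lemma PrimitiveAt.const (c : ℝ) :
    PrimitiveAt (fun y : M => (0 : TangentSpace (𝓡 n) y →L[ℝ] ℝ)) (fun _ => c) x :=
  Filter.Eventually.of_forall fun _ => ⟨contMDiffAt_const, (mvfderiv_const c).symm⟩

lemma PrimitiveAt.const_mul (c : ℝ) (hf : PrimitiveAt α f x) :
    PrimitiveAt (fun y => c • α y) (fun y => c * f y) x := by
  filter_upwards [hf] with y h1
  refine ⟨contMDiffAt_const.mul h1.1, ?_⟩
  rw [mvfderiv_fun_mul (mdifferentiableAt_of_smooth contMDiffAt_const) (mdifferentiableAt_of_smooth h1.1), mvfderiv_const, h1.2]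
  simp

lemma PrimitiveAt.sum {ι : Type*} (s : Finset ι) {α : ι → ∀ x : M, TangentSpace (𝓡 n) x →L[ℝ] ℝ}
    {f : ι → M → ℝ} (h : ∀ i ∈ s, PrimitiveAt (α i) (f i) x) :
    PrimitiveAt (fun y => ∑ i ∈ s, α i y) (fun y => ∑ i ∈ s, f i y) x := by
  classical
  induction s using Finset.induction_on with
  | empty => simpa using PrimitiveAt.const 0
  | insert i s hi ih =>
    simp only [Finset.sum_insert hi]
    exact (h i (by simp)).add (ih fun j hj => h j (by simp [hj]))

lemma PrimitiveAt.congr_form (hf : PrimitiveAt α f x) (h : ∀ᶠ y in 𝓝 x, β y = α y) :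
    PrimitiveAt β f x := by
  filter_upwards [hf, h] with y h1 h2
  exact ⟨h1.1, h2.trans h1.2⟩

lemma PrimitiveAt.congr_fun (hf : PrimitiveAt α f x) (h : ∀ᶠ y in 𝓝 x, g y = f y) : PrimitiveAt α g
    x := by
  filter_upwards [hf, h.eventually_nhds] with y h1 h2
  refine ⟨h1.1.congr_of_eventuallyEq h2, ?_⟩
  rw [h1.2, mvfderiv, mvfderiv, Filter.EventuallyEq.mfderiv_eq h2, h2.self_of_nhds]

lemma PrimitiveAt.eventually (hf : PrimitiveAt α f x) : ∀ᶠ y in 𝓝 x, PrimitiveAt α f y :=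
  hf.eventually_nhds

lemma primitiveAt_of_contMDiff (hf : ContMDiff (𝓡 n) 𝓘(ℝ, ℝ) ∞ f) : PrimitiveAt (mvfderiv (𝓡 n) f)
    f x :=
  Filter.Eventually.of_forall fun y => ⟨hf y, rfl⟩

lemma primitiveAt_iff : PrimitiveAt α f x ↔ ∃ U : Set M, IsOpen U ∧ x ∈ U ∧
      ContMDiffOn (𝓡 n) 𝓘(ℝ, ℝ) ∞ f U ∧ ∀ y ∈ U, α y = mvfderiv (𝓡 n) f y := by
  constructor
  · intro h
    obtain ⟨U, hU, hUo, hx⟩ := eventually_nhds_iff.1 h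
    exact ⟨U, hUo, hx, fun y hy => (hU y hy).1.contMDiffWithinAt, fun y hy => (hU y hy).2⟩
  · rintro ⟨U, hUo, hx, h1, h2⟩
    filter_upwards [hUo.mem_nhds hx] with y hy
    exact ⟨h1.contMDiffAt (hUo.mem_nhds hy), h2 y hy⟩

lemma isOpen_target (p : M) : IsOpen (extChartAt (𝓡 n) p).target := isOpen_extChartAt_target p

lemma inChart_eq_fderiv {θ : OneForm n M} {f : M → ℝ} {p : M} {y : EuclideanSpace ℝ (Fin n)}
    (hy : y ∈ (extChartAt (𝓡 n) p).target) (hf : ContMDiffAt (𝓡 n) 𝓘(ℝ, ℝ) ∞ f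
        ((extChartAt (𝓡 n) p).symm y))
    (h : θ ((extChartAt (𝓡 n) p).symm y) = mvfderiv (𝓡 n) f ((extChartAt (𝓡 n) p).symm y)) :
    inChart θ p y = fderiv ℝ (f ∘ (extChartAt (𝓡 n) p).symm) y := by
  rw [inChart, h]
  have hs : MDifferentiableAt 𝓘(ℝ, EuclideanSpace ℝ (Fin n)) (𝓡 n) (extChartAt (𝓡 n) p).symm y :=
    ((contMDiffOn_extChartAt_symm p).contMDiffAt ((isOpen_target (n := n) p).mem_nhds
        hy)).mdifferentiableAt (n := ∞) (by simp)
  have := mvfderiv_comp y (mdifferentiableAt_of_smooth hf) hs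
  erw [← this]
  rw [mvfderiv, mfderiv_eq_fderiv]
  rfl

lemma closed_of_primitives {θ : OneForm n M} (h : ∀ x, ∃ f, PrimitiveAt (n := n) θ f x) :
    IsClosedForm θ := by
  intro p y hy u w
  obtain ⟨f, hf⟩ := h ((extChartAt (𝓡 n) p).symm y)
  have hc : Filter.Tendsto (extChartAt (𝓡 n) p).symm (𝓝 y) (𝓝 ((extChartAt (𝓡 n) p).symm y)) :=
    ((continuousOn_extChartAt_symm p).continuousAt ((isOpen_target (n := n) p).mem_nhds hy))
  have he : inChart θ p =ᶠ[𝓝 y] fderiv ℝ (f ∘ (extChartAt (𝓡 n) p).symm) := by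
    filter_upwards [hc.eventually hf, (isOpen_target (n := n) p).mem_nhds hy] with z hz hz'
    exact inChart_eq_fderiv hz' hz.1 hz.2
  have hs : ContDiffAt ℝ ∞ (f ∘ (extChartAt (𝓡 n) p).symm) y := by
    rw [← contMDiffAt_iff_contDiffAt]
    exact hf.self_of_nhds.1.comp y ((contMDiffOn_extChartAt_symm p).contMDiffAt
        ((isOpen_target (n := n) p).mem_nhds hy))
  rw [he.fderiv_eq]
  exact hs.isSymmSndFDerivAt
      (by simp [minSmoothness_of_isRCLikeNormedField]; exact WithTop.coe_le_coe.2 le_top) u w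

/-- The Poincaré lemma on a ball in the chart around each point, with symmetry of second derivatives
for the converse. It lets the rest of the proof work with primitives instead of `inChart`. -/
lemma closed_iff {θ : OneForm n M} : IsClosedForm (n := n) θ ↔ ∀ x : M, ∃ f, PrimitiveAt (n := n) θ
    f x := by
  refine ⟨fun h p => ?_, closed_of_primitives (θ := θ)⟩
  obtain ⟨r, hr, hB⟩ := Metric.isOpen_iff.1 (isOpen_target (n := n) p) _ (mem_extChartAt_target p)
  set B := Metric.ball (extChartAt (𝓡 n) p p) r
  have hc := (contDiffOn_inChart θ p).mono hB
  obtain ⟨F, hF⟩ := (convex_ball (extChartAt (𝓡 n) p p)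
      r).exists_forall_hasFDerivAt_of_fderiv_symmetric
    Metric.isOpen_ball (hc.differentiableOn (by simp)) (fun a ha x y => h p a (hB ha) x y)
  have hFs : ContDiffOn ℝ ∞ F B := by
    rw [contDiffOn_infty_iff_fderiv_of_isOpen Metric.isOpen_ball]
    refine ⟨fun a ha => (hF a ha).differentiableAt.differentiableWithinAt,
        hc.congr fun a ha => (hF a ha).fderiv⟩
  refine ⟨F ∘ extChartAt (𝓡 n) p, ?_⟩
  have h1 : ∀ᶠ y in 𝓝 p, extChartAt (𝓡 n) p y ∈ B :=
    (continuousAt_extChartAt (I := 𝓡 n) p).eventually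
        (Metric.isOpen_ball.mem_nhds (Metric.mem_ball_self hr))
  filter_upwards [h1, (isOpen_extChartAt_source (I := 𝓡 n) p).mem_nhds
      (mem_extChartAt_source (I := 𝓡 n) p)] with y hy hy'
  have hy'' : y ∈ (chartAt (EuclideanSpace ℝ (Fin n)) p).source := by simpa using hy'
  have hch : ContMDiffAt (𝓡 n) 𝓘(ℝ, EuclideanSpace ℝ (Fin n)) ∞ (extChartAt (𝓡 n) p) y :=
    contMDiffAt_extChartAt' hy''
  have hsm : ContMDiffAt (𝓡 n) 𝓘(ℝ, ℝ) ∞ (F ∘ extChartAt (𝓡 n) p) y := by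
    refine ContMDiffAt.comp y ?_ hch
    rw [contMDiffAt_iff_contDiffAt]
    exact hFs.contDiffAt (Metric.isOpen_ball.mem_nhds hy)
  refine ⟨hsm, ?_⟩
  have h2 : inChart θ p (extChartAt (𝓡 n) p y) = fderiv ℝ F (extChartAt (𝓡 n) p y) :=
      (hF _ hy).fderiv.symm
  have hd : mfderiv (𝓡 n) 𝓘(ℝ, ℝ) (F ∘ extChartAt (𝓡 n) p) y =
      (fderiv ℝ F (extChartAt (𝓡 n) p y)).comp (mfderiv (𝓡 n) 𝓘(ℝ, EuclideanSpace ℝ (Fin n))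
          (extChartAt (𝓡 n) p) y) := by
    have hdF : MDifferentiableAt 𝓘(ℝ, EuclideanSpace ℝ (Fin n)) 𝓘(ℝ, ℝ) F (extChartAt (𝓡 n) p y) :=
      (hF _ hy).differentiableAt.mdifferentiableAt
    rw [mfderiv_comp y hdF (hch.mdifferentiableAt (by simp)), mfderiv_eq_fderiv]
    rfl
  have hid : ((mfderiv 𝓘(ℝ, EuclideanSpace ℝ (Fin n)) (𝓡 n) (extChartAt (𝓡 n) p).symm
      (extChartAt (𝓡 n) p y))).comp
      (mfderiv (𝓡 n) 𝓘(ℝ, EuclideanSpace ℝ (Fin n)) (extChartAt (𝓡 n) p) y) =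
          ContinuousLinearMap.id ℝ (TangentSpace (𝓡 n) y) := by
    have := mfderivWithin_extChartAt_symm_comp_mfderiv_extChartAt' (I := 𝓡 n) hy'
    simpa using this
  ext w
  have h3 : inChart θ p (extChartAt (𝓡 n) p y) (mfderiv (𝓡 n) 𝓘(ℝ, EuclideanSpace ℝ (Fin n))
      (extChartAt (𝓡 n) p) y w) =
      fderiv ℝ F (extChartAt (𝓡 n) p y) (mfderiv (𝓡 n) 𝓘(ℝ, EuclideanSpace ℝ (Fin n))
          (extChartAt (𝓡 n) p) y w) := by rw [h2]
  have h4 : mfderiv 𝓘(ℝ, EuclideanSpace ℝ (Fin n)) (𝓡 n) (extChartAt (𝓡 n) p).symm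
      (extChartAt (𝓡 n) p y)
      (mfderiv (𝓡 n) 𝓘(ℝ, EuclideanSpace ℝ (Fin n)) (extChartAt (𝓡 n) p) y w) = w :=
          congrArg (fun L => L w) hid
  have h5 : mfderiv (𝓡 n) 𝓘(ℝ, ℝ) (F ∘ extChartAt (𝓡 n) p) y w =
      (fderiv ℝ F (extChartAt (𝓡 n) p y)) (mfderiv (𝓡 n) 𝓘(ℝ, EuclideanSpace ℝ (Fin n))
          (extChartAt (𝓡 n) p) y w) := congrArg (fun L => L w) hd
  refine Eq.trans ?_ (h3.trans h5.symm)
  -- The point recovered from its chart image equals `y` only propositionally, so covectors in the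
  -- two fibres are compared on the common model space.
  have h6 : ∀ z, z = y → ∀ u : EuclideanSpace ℝ (Fin n), θ z u = θ y u := by
    rintro z rfl u; rfl
  refine Eq.trans ?_ (h6 _ ((extChartAt (𝓡 n) p).left_inv hy') _).symm
  exact congrArg (θ y) h4.symm

lemma PrimitiveAt.eventually_eq (h : PrimitiveAt (fun y : M => (0 : TangentSpace (𝓡 n) y →L[ℝ] ℝ))
    f x) :
    ∀ᶠ y in 𝓝 x, f y = f x := by
  have hc : Filter.Tendsto (extChartAt (𝓡 n) x).symm (𝓝 (extChartAt (𝓡 n) x x)) (𝓝 x) := by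
    have := (continuousAt_extChartAt_symm (I := 𝓡 n) x)
    rwa [ContinuousAt, extChartAt_to_inv] at this
  obtain ⟨r, hr, hB⟩ := Metric.eventually_nhds_iff_ball.1
    ((hc.eventually h).and ((isOpen_target (n := n) x).mem_nhds (mem_extChartAt_target x)))
  set B := Metric.ball (extChartAt (𝓡 n) x x) r
  have hsm : ∀ y ∈ B, HasFDerivAt (f ∘ (extChartAt (𝓡 n) x).symm)
      (0 : EuclideanSpace ℝ (Fin n) →L[ℝ] ℝ) y := by
    intro y hy
    have h1 := hB y hy
    have hs : ContDiffAt ℝ ∞ (f ∘ (extChartAt (𝓡 n) x).symm) y := by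
      rw [← contMDiffAt_iff_contDiffAt]
      exact h1.1.1.comp y ((contMDiffOn_extChartAt_symm x).contMDiffAt
          ((isOpen_target (n := n) x).mem_nhds h1.2))
    have h2 := inChart_eq_fderiv (θ := 0) h1.2 h1.1.1 (h1.1.2)
    have h3 : fderiv ℝ (f ∘ (extChartAt (𝓡 n) x).symm) y = 0 := by
      rw [← h2]; rfl
    rw [← h3]
    exact (hs.differentiableAt (by simp)).hasFDerivAt
  have hconst : ∀ y ∈ B, f ((extChartAt (𝓡 n) x).symm y) = f x := by
    intro y hy
    have := (convex_ball (extChartAt (𝓡 n) x x) r).is_const_of_fderivWithin_eq_zero (𝕜 := ℝ)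
        (f := f ∘ (extChartAt (𝓡 n) x).symm)
      (fun z hz => (hsm z hz).differentiableAt.differentiableWithinAt)
      (fun z hz => by rw [fderivWithin_of_isOpen Metric.isOpen_ball hz, (hsm z hz).fderiv]) hy
          (Metric.mem_ball_self hr)
    simpa using this
  have h1 : ∀ᶠ y in 𝓝 x, extChartAt (𝓡 n) x y ∈ B :=
    (continuousAt_extChartAt (I := 𝓡 n) x).eventually
        (Metric.isOpen_ball.mem_nhds (Metric.mem_ball_self hr))
  filter_upwards [h1, (isOpen_extChartAt_source (I := 𝓡 n) x).mem_nhds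
      (mem_extChartAt_source (I := 𝓡 n) x)] with y hy hy'
  have := hconst _ hy
  rwa [(extChartAt (𝓡 n) x).left_inv hy'] at this

/-- The source of all transition constants: the difference of two primitives has zero derivative,
hence is locally constant. -/
lemma PrimitiveAt.sub_eventually_eq (hf : PrimitiveAt α f x) (hg : PrimitiveAt α g x) :
    ∀ᶠ y in 𝓝 x, f y - g y = f x - g x := by
  have := hf.sub hg
  simp only [sub_self] at this
  exact this.eventually_eq

lemma exact_iff {θ : OneForm n M} : IsExactForm (n := n) θ ↔ ∃ f, ∀ x : M, PrimitiveAt (n := n) θ f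
    x :=
  ⟨fun ⟨f, h1, h2⟩ => ⟨f, fun _ => Filter.Eventually.of_forall fun y => ⟨h1 y, h2 y⟩⟩,
   fun ⟨f, h⟩ => ⟨f, fun x => (h x).self_of_nhds.1, fun x => (h x).self_of_nhds.2⟩⟩

end

end

/-! ### Integral forms and the decomposition of closed forms -/

section

/-- Additive coordinates on `ℝ` that are integral on a given finite set. -/
lemma exists_integral_coordinates {S : Set ℝ} (hS : S.Finite) :
    ∃ (d : ℕ) (b : Fin d → ℝ) (φ : Fin d → ℝ →+ ℝ), ∀ c ∈ S,
      (∀ l, ∃ k : ℤ, φ l c = k) ∧ ∑ l, b l * φ l c = c := by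
  have : Module.Finite ℤ (Submodule.span ℤ S) := Module.Finite.span_of_finite ℤ hS
  have : Module.Free ℤ (Submodule.span ℤ S) := inferInstance
  set B := Module.finBasis ℤ (Submodule.span ℤ S)
  set b : Fin _ → ℝ := fun l => (B l : ℝ) with hbdef
  have hbZ : LinearIndependent ℤ b :=
    B.linearIndependent.map' (Submodule.span ℤ S).subtype (Submodule.ker_subtype _)
  have hb : LinearIndependent ℚ b := (LinearIndependent.iff_fractionRing ℤ ℚ).1 hbZ
  -- The coordinate functionals are extended `ℚ`-linearly to all of `ℝ`, because later they are
  -- applied to the values of the primitives themselves and not only to differences in `S`.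
  have hφ : ∀ l, ∃ φ : ℝ →ₗ[ℚ] ℚ, ∀ m, φ (b m) = if m = l then 1 else 0 := by
    intro l
    obtain ⟨φ, hφ⟩ := LinearMap.exists_extend ((Finsupp.lapply l : _ →ₗ[ℚ] ℚ) ∘ₗ hb.repr)
    refine ⟨φ, fun m => ?_⟩
    have := LinearMap.congr_fun hφ ⟨b m, Submodule.subset_span ⟨m, rfl⟩⟩
    simp only [LinearMap.comp_apply, Submodule.subtype_apply] at this
    rw [this]
    simp [hb.repr_eq_single m ⟨b m, Submodule.subset_span ⟨m, rfl⟩⟩ rfl, Finsupp.single_apply]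
  choose φ hφ using hφ
  refine ⟨_, b, fun l => (Rat.castHom ℝ).toAddMonoidHom.comp (φ l).toAddMonoidHom, fun c hc => ?_⟩
  set c' : Submodule.span ℤ S := ⟨c, Submodule.subset_span hc⟩
  have hc' : c = ∑ m, (B.repr c' m) • b m := by
    have := congrArg (Submodule.span ℤ S).subtype (B.sum_repr c')
    simp only [map_sum, map_smul] at this
    exact this.symm
  have hl : ∀ l, φ l c = B.repr c' l := by
    intro l
    conv_lhs => rw [hc', map_sum]
    simp only [map_zsmul, hφ]
    simp
  have hl' : ∀ l, ((Rat.castHom ℝ).toAddMonoidHom.comp (φ l).toAddMonoidHom) c =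
      ((B.repr c' l : ℤ) : ℝ) := by
    intro l
    simp [hl]
  refine ⟨fun l => ⟨_, hl' l⟩, ?_⟩
  simp only [hl']
  conv_rhs => rw [hc']
  simp [mul_comm]

/-- `θ` is the logarithmic differential `dE / (2πi E)` of a map `E` to the unit circle. -/
def IsIntegralForm (θ : OneForm n M) : Prop :=
  ∃ E : M → ℂ, ∀ x : M, ∃ f, PrimitiveAt (n := n) θ f x ∧
    ∀ᶠ y in 𝓝 x, E y = Complex.exp (2 * Real.pi * Complex.I * f y)

lemma IsIntegralForm.isClosedForm {θ : OneForm n M} (h : IsIntegralForm (n := n) θ) :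
    IsClosedForm (n := n) θ := by
  obtain ⟨E, hE⟩ := h
  exact closed_iff.2 fun x => ⟨_, (hE x).choose_spec.1⟩

lemma IsCompact.finite_image_of_locally_const {X : Type*} [TopologicalSpace X] {K : Set X}
    (hK : IsCompact K)
    {f : X → ℝ} (h : ∀ x ∈ K, ∀ᶠ y in 𝓝 x, f y = f x) : (f '' K).Finite := by
  obtain ⟨t, ht, hc⟩ := hK.elim_nhds_subcover (fun x => {y | f y = f x}) h
  refine (t.finite_toSet.image f).subset ?_
  rintro _ ⟨y, hy, rfl⟩
  obtain ⟨x, hx, hy⟩ := mem_iUnion₂.1 (hc hy)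
  exact ⟨x, hx, Eq.symm hy⟩

/-- Differentiate `∑ ρ k = 1`. This makes the form `α` below independent of the index `j` of the
local primitive. -/
lemma mvfderiv_partition_sum {ι : Type*} [Fintype ι] [T2Space M]
    (ρ : SmoothPartitionOfUnity ι (𝓡 n) M univ) (y : M) :
    ∑ k, mvfderiv (𝓡 n) (ρ k) y = 0 := by
  have h1 : PrimitiveAt (fun z => ∑ k, mvfderiv (𝓡 n) (ρ k) z) (fun z => ∑ k, ρ k z) y :=
    PrimitiveAt.sum _ fun k _ => primitiveAt_of_contMDiff (ρ k).contMDiff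
  have h2 : (fun z : M => ∑ k, ρ k z) = fun _ => 1 := by
    ext z
    rw [← finsum_eq_sum_of_fintype]
    exact ρ.sum_eq_one (mem_univ z)
  rw [h2] at h1
  exact h1.self_of_nhds.2.trans (mvfderiv_const 1)

lemma sum_smul_apply {ι : Type*} (s : Finset ι) (b : ι → ℝ) (A : ι → OneForm n M) (y : M) :
    (∑ l ∈ s, b l • A l) y = ∑ l ∈ s, b l • A l y := by
  have := map_sum (ContMDiffSection.coeAddHom (𝓡 n) (EuclideanSpace ℝ (Fin n) →L[ℝ] ℝ) ∞
    (fun x : M => TangentSpace (𝓡 n) x →L[ℝ] Bundle.Trivial M ℝ x)) (fun l => b l • A l) s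
  have := congrFun this y
  simp only [ContMDiffSection.coeAddHom_apply, Finset.sum_apply] at this
  exact this

/-- Every closed 1-form is, up to an exact form, a linear combination of integral forms. -/
lemma IsClosedForm.exists_integral_decomposition [T2Space M] [CompactSpace M] {η : OneForm n M}
    (hη : IsClosedForm (n := n) η) :
    ∃ (d : ℕ) (b : Fin d → ℝ) (α : Fin d → OneForm n M) (ε : OneForm n M),
      (∀ l, IsIntegralForm (n := n) (α l)) ∧ IsExactForm (n := n) ε ∧ η = ∑ l, b l • α l + ε := by
  have : LocallyCompactSpace M := ChartedSpace.locallyCompactSpace (EuclideanSpace ℝ (Fin n)) M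
  choose f hf using closed_iff.1 hη
  have hnb : ∀ x, ∃ K : Set M, IsCompact K ∧ K ∈ 𝓝 x ∧ ∀ y ∈ K, PrimitiveAt (n := n) η (f x) y := by
    intro x
    obtain ⟨K, hKn, hKs, hK⟩ := local_compact_nhds (hf x).eventually
    exact ⟨K, hK, hKn, fun y hy => hKs hy⟩
  choose K hKc hKn hKp using hnb
  obtain ⟨t, ht⟩ := CompactSpace.elim_nhds_subcover (fun x => interior (K x))
    (fun x => interior_mem_nhds.2 (hKn x))
  obtain ⟨ρ, hρ⟩ := SmoothPartitionOfUnity.exists_isSubordinate (𝓡 n) (isClosed_univ (X := M))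
    (fun i : t => interior (K i)) (fun i => isOpen_interior) (by
      intro x _
      have : x ∈ ⋃ x ∈ t, interior (K x) := by rw [ht]; trivial
      simpa using this)
  have hρ1 : ∀ y, ∑ k, ρ k y = 1 := fun y => by
    rw [← finsum_eq_sum_of_fintype]; exact ρ.sum_eq_one (mem_univ y)
  have hρ0 : ∀ (k : t) y, y ∉ interior (K k) → ρ k y = 0 := fun k y hy =>
    image_eq_zero_of_notMem_tsupport fun h => hy (hρ k h)
  have hcov : ∀ x, ∃ i : t, x ∈ interior (K i) := by
    intro x
    have : x ∈ ⋃ x ∈ t, interior (K x) := by rw [ht]; trivial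
    simpa using this
  choose i hi using hcov
  have hlc : ∀ (j k : t) (x : M), x ∈ K j → x ∈ K k → ∀ᶠ y in 𝓝 x, f j y - f k y = f j x - f k x :=
    fun j k x hj hk => (hKp j x hj).sub_eventually_eq (hKp k x hk)
  set S : Set ℝ := ⋃ j : t, ⋃ k : t, (fun y => f j y - f k y) '' (K j ∩ K k) with hSdef
  have hSf : S.Finite := finite_iUnion fun j => finite_iUnion fun k =>
    IsCompact.finite_image_of_locally_const ((hKc j).inter (hKc k)) fun x hx => hlc j k x hx.1 hx.2
  have hS : ∀ (j k : t) (y : M), y ∈ K j → y ∈ K k → f j y - f k y ∈ S := fun j k y hj hk =>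
    mem_iUnion₂.2 ⟨j, k, y, ⟨hj, hk⟩, rfl⟩
  obtain ⟨d, b, φ, hφ⟩ := exists_integral_coordinates hSf
  -- The `l`-th coordinates of the transition constants form a cocycle; `h l j` is its smooth
  -- trivialization by the partition of unity. Additivity of `φ l` and `∑ dρ k = 0` remove `f j`
  -- from `d (h l j)`, which leaves the global formula `α l`, although `φ l ∘ f k` alone need not be
  -- continuous.
  set h : Fin d → t → M → ℝ := fun l j y => ∑ k : t, φ l (f j y - f k y) * ρ k y with hdef
  set α : Fin d → ∀ y : M, TangentSpace (𝓡 n) y →L[ℝ] ℝ :=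
    fun l y => - ∑ k : t, φ l (f k y) • mvfderiv (𝓡 n) (ρ k) y with hα
  have hprim : ∀ l (j : t) x, x ∈ interior (K j) → PrimitiveAt (α l) (h l j) x := by
    intro l j x hx
    have h1 : PrimitiveAt (fun y => ∑ k : t, φ l (f j y - f k y) • mvfderiv (𝓡 n) (ρ k) y) (h l j)
        x := by
      refine PrimitiveAt.sum _ fun k _ => ?_
      have hk := (primitiveAt_of_contMDiff (x := x) (ρ k).contMDiff)
      by_cases hxk : x ∈ tsupport (ρ k)
      · have hc := hlc j k x (interior_subset hx) (interior_subset (hρ k hxk))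
        refine ((hk.const_mul (φ l (f j x - f k x))).congr_form ?_).congr_fun ?_
        all_goals filter_upwards [hc] with y hy; rw [hy]
      · have h0 : ∀ᶠ y in 𝓝 x, ρ k y = 0 := notMem_tsupport_iff_eventuallyEq.1 hxk
        have hd : ∀ᶠ y in 𝓝 x, mvfderiv (𝓡 n) (ρ k) y = 0 := by
          filter_upwards [((PrimitiveAt.const (n := n) (x := x) 0).congr_fun h0)] with y hy
          exact hy.2.symm
        refine ((PrimitiveAt.const (n := n) (x := x) 0).congr_form ?_).congr_fun ?_
        · filter_upwards [hd] with y hy; rw [hy, smul_zero]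
        · filter_upwards [h0] with y hy; rw [hy, mul_zero]
    refine h1.congr_form (Filter.Eventually.of_forall fun y => ?_)
    simp only [map_sub, sub_smul, Finset.sum_sub_distrib, ← Finset.smul_sum,
        mvfderiv_partition_sum, hα]
    simp
  set A : Fin d → OneForm n M := fun l => ofPrimitives (α l) fun x => ⟨_, hprim l (i x) x (hi x)⟩
  have hAprim : ∀ l x, PrimitiveAt (n := n) (A l) (h l (i x)) x := fun l x => hprim l (i x) x (hi x)
  have hdiff : ∀ l (j j' : t) y, h l j y - h l j' y = φ l (f j y - f j' y) := by
    intro l j j' y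
    simp only [hdef, ← Finset.sum_sub_distrib, ← sub_mul, map_sub, sub_sub_sub_cancel_right]
    rw [← Finset.mul_sum, hρ1, mul_one]
  have hεprim : ∀ x, PrimitiveAt (n := n) (η - ∑ l, b l • A l) (fun y => ∑ k : t, ρ k y * f k y) x
      := by
    intro x
    have h1 := (hKp (i x) x (interior_subset (hi x))).sub
      (PrimitiveAt.sum Finset.univ fun l _ => (hAprim l x).const_mul (b l))
    refine (h1.congr_form (Filter.Eventually.of_forall fun y => ?_)).congr_fun ?_
    · rw [ContMDiffSection.coe_sub, Pi.sub_apply, sum_smul_apply]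
    · filter_upwards [isOpen_interior.mem_nhds (hi x)] with y hy
      -- Where `ρ k` does not vanish, `f (i x) y - f k y` lies in `S` and is recovered from its
      -- coordinates. Hence the primitive `f - ∑ b l * h l` of the remainder becomes the global
      -- function `∑ ρ k * f k`.
      have h2 : ∀ k : t, (∑ l, b l * φ l (f (i x) y - f k y)) * ρ k y = (f (i x) y - f k y) * ρ k y
          := by
        intro k
        by_cases hk : y ∈ interior (K k)
        · rw [(hφ _ (hS (i x) k y (interior_subset hy) (interior_subset hk))).2]
        · rw [hρ0 k y hk, mul_zero, mul_zero]
      have h3 : ∑ l, b l * h l (i x) y = ∑ k : t, (f (i x) y - f k y) * ρ k y := by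
        simp only [← h2, hdef, Finset.mul_sum, Finset.sum_mul]
        rw [Finset.sum_comm]
        simp only [mul_assoc]
      rw [h3]
      simp only [sub_mul, Finset.sum_sub_distrib, ← Finset.mul_sum, hρ1]
      simp [mul_comm]
  refine ⟨d, b, A, η - ∑ l, b l • A l, fun l => ?_, exact_iff.2 ⟨_, hεprim⟩, by abel⟩
  -- Another choice of index changes `h l` by a value of `φ l` on `S`, an integer, so the
  -- exponential does not see it.
  refine ⟨fun y => Complex.exp (2 * Real.pi * Complex.I * h l (i y) y),
      fun x => ⟨_, hAprim l x, ?_⟩⟩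
  filter_upwards [isOpen_interior.mem_nhds (hi x)] with y hy
  obtain ⟨k, hk⟩ := (hφ _ (hS (i y) (i x) y (interior_subset (hi y)) (interior_subset hy))).1 l
  rw [Complex.exp_eq_exp_iff_exists_int]
  refine ⟨k, ?_⟩
  have := hdiff l (i y) (i x) y
  rw [hk, sub_eq_iff_eq_add] at this
  rw [this]
  push_cast
  ring

end

/-! ### Line integrals -/

section

section LineIntegral

/-- The integrand of the line integral of `θ` along `γ`. -/
def integrand (θ : OneForm n M) {x y : M} (γ : Path x y) (t : ℝ) : ℝ :=
  θ (γ.extend t) (mfderivWithin 𝓘(ℝ, ℝ) (𝓡 n) γ.extend (Set.Icc 0 1) t (1 : ℝ))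

variable {x y : M} {γ : Path x y}

lemma continuousOn_integrand (θ : OneForm n M) (hγ : IsSmoothPath n γ) :
    ContinuousOn (integrand θ γ) (Icc 0 1) := by
  have h1 : ContMDiffOn 𝓘(ℝ, ℝ) ((𝓡 n).prod 𝓘(ℝ, EuclideanSpace ℝ (Fin n) →L[ℝ] ℝ)) ∞
      (fun t => TotalSpace.mk' (EuclideanSpace ℝ (Fin n) →L[ℝ] ℝ)
        (E := fun x : M => TangentSpace (𝓡 n) x →L[ℝ] Bundle.Trivial M ℝ x) (γ.extend t)
            (θ (γ.extend t))) (Icc 0 1) :=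
    θ.contMDiff.comp_contMDiffOn hγ
  have h2 := (hγ.continuousOn_tangentMapWithin (by simp)
      (uniqueDiffOn_Icc_zero_one.uniqueMDiffOn)).comp
    (f := fun t : ℝ => (⟨t, (1 : ℝ)⟩ : TangentBundle 𝓘(ℝ, ℝ) ℝ)) (s := Icc 0 1) ?_ (fun t ht => ht)
  · have h3 := h1.continuousOn.clm_bundle_apply (E₁ := (TangentSpace (𝓡 n) : M → Type))
        (v := fun t => (mfderivWithin 𝓘(ℝ, ℝ) (𝓡 n) γ.extend (Set.Icc 0 1) t (1 : ℝ))) h2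
    intro t ht
    have h4 := (FiberBundle.continuousWithinAt_totalSpace _ _).1 (h3 t ht)
    exact h4.2
  · refine Continuous.continuousOn ?_
    exact (tangentBundleModelSpaceHomeomorph 𝓘(ℝ, ℝ)).symm.continuous.comp
        (continuous_id.prodMk continuous_const)

lemma PrimitiveAt.hasDerivWithinAt {θ : OneForm n M} (hγ : IsSmoothPath n γ) {f : M → ℝ} {t : ℝ}
    (ht : t ∈ Icc (0 : ℝ) 1)
    (hf : PrimitiveAt (n := n) θ f (γ.extend t)) :
    HasDerivWithinAt (f ∘ γ.extend) (integrand θ γ t) (Icc 0 1) t := by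
  have h1 : MDifferentiableWithinAt 𝓘(ℝ, ℝ) (𝓡 n) γ.extend (Icc 0 1) t :=
      (hγ t ht).mdifferentiableWithinAt (by simp)
  have h2 := (mdifferentiableAt_of_smooth hf.self_of_nhds.1).hasMFDerivAt.comp_hasMFDerivWithinAt t h1.hasMFDerivWithinAt
  have h3 := HasFDerivWithinAt.hasDerivWithinAt (𝕜 := ℝ) (F := ℝ)
      (hasMFDerivWithinAt_iff_hasFDerivWithinAt.1 h2)
  convert h3 using 1
  rw [integrand, hf.self_of_nhds.2]
  rfl

lemma exists_antiderivative (θ : OneForm n M) (hγ : IsSmoothPath n γ) :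
    ∃ u : ℝ → ℝ, u 0 = 0 ∧ u 1 = lineIntegral θ γ ∧ ∀ t ∈ Icc (0 : ℝ) 1,
      HasDerivWithinAt u (integrand θ γ t) (Icc 0 1) t := by
  have hc := continuousOn_integrand θ hγ
  -- Extending the integrand constantly beyond `[0, 1]` makes it continuous on `ℝ`, so the two-sided
  -- fundamental theorem applies at the endpoints too.
  set g : ℝ → ℝ := IccExtend (zero_le_one' ℝ) ((Icc (0 : ℝ) 1).domRestrict (integrand θ γ)) with hg
  have hgc : Continuous g := (continuousOn_iff_continuous_domRestrict.1 hc).Icc_extend'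
  have hgt : ∀ t ∈ Icc (0 : ℝ) 1, g t = integrand θ γ t := fun t ht => by
    rw [hg, IccExtend_of_mem _ _ ht]; rfl
  refine ⟨fun t => ∫ s in (0 : ℝ)..t, g s, by simp, ?_, fun t ht => ?_⟩
  · refine intervalIntegral.integral_congr fun t ht => ?_
    rw [uIcc_of_le zero_le_one] at ht
    exact hgt t ht
  · rw [← hgt t ht]
    exact (intervalIntegral.integral_hasDerivAt_right (hgc.intervalIntegrable _ _)
      (hgc.stronglyMeasurableAtFilter _ _) hgc.continuousAt).hasDerivWithinAt

lemma lineIntegral_eq_sub {θ : OneForm n M} (hγ : IsSmoothPath n γ) {u : ℝ → ℝ}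
    (hu : ∀ t ∈ Icc (0 : ℝ) 1, HasDerivWithinAt u (integrand θ γ t) (Icc 0 1) t) :
    lineIntegral θ γ = u 1 - u 0 := by
  obtain ⟨w, h0, h1, hw⟩ := exists_antiderivative θ hγ
  have hd : ∀ t ∈ Icc (0 : ℝ) 1, HasDerivWithinAt (fun t => u t - w t) 0 (Icc 0 1) t :=
      fun t ht => by
    simpa using (hu t ht).fun_sub (hw t ht)
  have := constant_of_derivWithin_zero (fun t ht => (hd t ht).differentiableWithinAt)
    (fun t ht => (hd t (Ico_subset_Icc_self ht)).derivWithin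
        (uniqueDiffOn_Icc_zero_one t (Ico_subset_Icc_self ht))) 1 (by simp)
  simp only [h0, h1] at this
  linarith

lemma lineIntegral_sum_smul_add {ι : Type*} (s : Finset ι) (b : ι → ℝ) (A : ι → OneForm n M)
    (ε : OneForm n M)
    (hγ : IsSmoothPath n γ) :
    lineIntegral (∑ l ∈ s, b l • A l + ε) γ = ∑ l ∈ s, b l * lineIntegral (A l) γ + lineIntegral ε
        γ := by
  choose u hu0 hu1 hu using fun l => exists_antiderivative (A l) hγ
  obtain ⟨w, hw0, hw1, hw⟩ := exists_antiderivative ε hγ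
  rw [lineIntegral_eq_sub hγ (u := fun t => ∑ l ∈ s, b l * u l t + w t)]
  · simp [hu0, hu1, hw0, hw1]
  · intro t ht
    have := (HasDerivWithinAt.fun_sum fun l (_ : l ∈ s) => (hu l t ht).const_mul (b l)).fun_add
        (hw t ht)
    refine this.congr_deriv (Eq.symm ?_)
    have hpt : ∀ z : M, (∑ l ∈ s, b l • A l + ε) z = ∑ l ∈ s, b l • A l z + ε z := fun z => by
      rw [← sum_smul_apply]; rfl
    have hlin : ∀ (L : ι → EuclideanSpace ℝ (Fin n) →L[ℝ] ℝ) (L' : EuclideanSpace ℝ (Fin n) →L[ℝ] ℝ)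
        (w : EuclideanSpace ℝ (Fin n)), (∑ l ∈ s, b l • L l + L') w = ∑ l ∈ s, b l * L l w + L' w
            := by
      intro L L' w
      simp
    unfold integrand
    rw [hpt]
    exact hlin (fun l => A l (γ.extend t)) (ε (γ.extend t)) _

lemma IsExactForm.lineIntegral_eq_zero {θ : OneForm n M} (h : IsExactForm (n := n) θ) {x : M}
    {γ : Path x x}
    (hγ : IsSmoothPath n γ) : lineIntegral θ γ = 0 := by
  obtain ⟨f, hf⟩ := exact_iff.1 h
  rw [lineIntegral_eq_sub hγ fun t ht => (hf _).hasDerivWithinAt hγ ht]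
  simp

lemma IsIntegralForm.lineIntegral_eq_int {θ : OneForm n M} (h : IsIntegralForm (n := n) θ) {x : M}
    {γ : Path x x}
    (hγ : IsSmoothPath n γ) : ∃ k : ℤ, lineIntegral θ γ = k := by
  obtain ⟨E, hE⟩ := h
  obtain ⟨u, hu0, hu1, hu⟩ := exists_antiderivative θ hγ
  -- Locally `E ∘ γ` is `exp (2πi f)` with `f ∘ γ - u` of derivative zero, so this product is
  -- constant; comparing the ends of the loop gives `exp (-2πi u 1) = 1`.
  have hd : ∀ t ∈ Icc (0 : ℝ) 1, HasDerivWithinAt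
      (fun t => E (γ.extend t) * Complex.exp (- (2 * Real.pi * Complex.I * u t))) 0 (Icc 0 1) t :=
          by
    intro t ht
    obtain ⟨f, hf, hfE⟩ := hE (γ.extend t)
    have h1 := (hf.hasDerivWithinAt hγ ht).sub (hu t ht)
    rw [sub_self] at h1
    have h2 := ((h1.ofReal_comp.const_mul (2 * Real.pi * Complex.I))).cexp
    simp only [Complex.ofReal_zero, mul_zero] at h2
    have hc : Filter.Tendsto γ.extend (𝓝[Icc 0 1] t) (𝓝 (γ.extend t)) :=
      γ.continuous_extend.continuousAt.continuousWithinAt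
    refine h2.congr_of_eventuallyEq_of_mem ?_ ht
    filter_upwards [hc.eventually hfE] with s hs
    rw [hs, ← Complex.exp_add]
    congr 1
    simp
    ring
  have h1 := constant_of_derivWithin_zero (fun t ht => (hd t ht).differentiableWithinAt)
    (fun t ht => (hd t (Ico_subset_Icc_self ht)).derivWithin
        (uniqueDiffOn_Icc_zero_one t (Ico_subset_Icc_self ht))) 1 (by simp)
  have hne : E x ≠ 0 := by
    obtain ⟨f, -, hfE⟩ := hE x
    rw [hfE.self_of_nhds]
    exact Complex.exp_ne_zero _
  simp only [hu0, hu1, Path.extend_one, Path.extend_zero, Complex.ofReal_zero] at h1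
  have h2 := mul_left_cancel₀ hne h1
  rw [Complex.exp_eq_exp_iff_exists_int] at h2
  obtain ⟨k, hk⟩ := h2
  refine ⟨-k, ?_⟩
  have h3 : (2 * Real.pi * Complex.I) * ((lineIntegral θ γ : ℂ) + k) = 0 := by
    linear_combination -hk
  have h4 := (mul_eq_zero.1 h3).resolve_left Complex.two_pi_I_ne_zero
  have h5 : lineIntegral θ γ + k = 0 := by exact_mod_cast h4
  push_cast
  linarith

end LineIntegral

end

/-! ### Smooth curves and exactness of forms without periods -/

section

/-- `u` is an antiderivative of `θ` along the curve `γ`. -/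
def IsAntiderivAlongAt (θ : OneForm n M) (γ : ℝ → M) (u : ℝ → ℝ) (t : ℝ) : Prop :=
  ∀ f, PrimitiveAt (n := n) θ f (γ t) → ∀ᶠ s in 𝓝 t, u s - f (γ s) = u t - f (γ t)

/-- There is a smooth curve, constant near `±∞`, from `x` to `y`, along which `θ` has integral `c`.
    -/
def JoinedWithIntegral (θ : OneForm n M) (x y : M) (c : ℝ) : Prop :=
  ∃ (γ : ℝ → M) (u : ℝ → ℝ), ContMDiff 𝓘(ℝ, ℝ) (𝓡 n) ∞ γ ∧ (∀ t, IsAntiderivAlongAt (n := n) θ γ u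
      t) ∧
    (∃ a, ∀ t ≤ a, γ t = x ∧ u t = 0) ∧ (∃ b, ∀ t ≥ b, γ t = y ∧ u t = c)

variable {θ : OneForm n M} {x y z : M} {c c' : ℝ}

lemma IsAntiderivAlongAt.congr {γ γ' : ℝ → M} {u u' : ℝ → ℝ} {t : ℝ}
    (h : IsAntiderivAlongAt (n := n) θ γ u t)
    (hγ : γ' =ᶠ[𝓝 t] γ) (hu : u' =ᶠ[𝓝 t] u) : IsAntiderivAlongAt (n := n) θ γ' u' t := by
  intro f hf
  rw [hγ.self_of_nhds] at hf
  filter_upwards [h f hf, hγ, hu] with s h1 h2 h3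
  rw [h2, h3, hγ.self_of_nhds, hu.self_of_nhds, h1]

lemma IsAntiderivAlongAt.comp {γ : ℝ → M} {u : ℝ → ℝ} {t : ℝ} {r : ℝ → ℝ} (k : ℝ)
    (h : IsAntiderivAlongAt (n := n) θ γ u (r t)) (hr : ContinuousAt r t) :
    IsAntiderivAlongAt (n := n) θ (γ ∘ r) (fun s => u (r s) + k) t := by
  intro f hf
  filter_upwards [hr.eventually (h f hf)] with s h1
  simp only [Function.comp]
  linarith

lemma JoinedWithIntegral.symm (h : JoinedWithIntegral (n := n) θ x y c) : JoinedWithIntegral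
    (n := n) θ y x (-c) := by
  obtain ⟨γ, u, hγ, hu, ⟨a, ha⟩, b, hb⟩ := h
  refine ⟨γ ∘ Neg.neg, fun s => u (-s) + -c, hγ.comp contDiff_neg.contMDiff,
    fun t => (hu (-t)).comp _ continuous_neg.continuousAt, ⟨-b, fun t ht => ?_⟩,
        ⟨-a, fun t ht => ?_⟩⟩
  · simp [hb (-t) (by linarith)]
  · simp [ha (-t) (by linarith)]

/-- Because the curves are constant near their ends, they can be glued smoothly: the shift `r` takes
`b + 1` to `a' - 1`, so both formulas agree on the interval `(b, b + 2)`. -/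
lemma JoinedWithIntegral.trans (h : JoinedWithIntegral (n := n) θ x y c)
    (h' : JoinedWithIntegral (n := n) θ y z c') :
    JoinedWithIntegral (n := n) θ x z (c + c') := by
  obtain ⟨γ, u, hγ, hu, ⟨a, ha⟩, b, hb⟩ := h
  obtain ⟨γ', u', hγ', hu', ⟨a', ha'⟩, b', hb'⟩ := h'
  set r : ℝ → ℝ := fun t => t - (b + 1) + (a' - 1) with hr
  have hrc : Continuous r := by fun_prop
  have hγ2 : ContMDiff 𝓘(ℝ, ℝ) (𝓡 n) ∞ (γ' ∘ r) := by
    refine hγ'.comp (ContDiff.contMDiff ?_)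
    fun_prop
  set γ'' : ℝ → M := fun t => if t ≤ b + 1 then γ t else (γ' ∘ r) t
  set u'' : ℝ → ℝ := fun t => if t ≤ b + 1 then u t else u' (r t) + c
  have hL : ∀ t < b + 2, γ'' t = γ t ∧ u'' t = u t := by
    intro t ht
    by_cases h : t ≤ b + 1
    · simp [γ'', u'', h]
    · have h1 := ha' (r t) (by simp only [hr]; linarith)
      have h2 := hb t (by linarith)
      simp [γ'', u'', h, h1, h2]
  have hR : ∀ t > b, γ'' t = (γ' ∘ r) t ∧ u'' t = u' (r t) + c := by
    intro t ht
    by_cases h : t ≤ b + 1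
    · have h1 := ha' (r t) (by simp only [hr]; linarith)
      have h2 := hb t (by linarith)
      simp [γ'', u'', h, h1, h2]
    · simp [γ'', u'', h]
  have hcase : ∀ t, (γ'' =ᶠ[𝓝 t] γ ∧ u'' =ᶠ[𝓝 t] u) ∨
      (γ'' =ᶠ[𝓝 t] γ' ∘ r ∧ u'' =ᶠ[𝓝 t] fun s => u' (r s) + c) := by
    intro t
    rcases lt_or_ge t (b + 2) with h | h
    · left
      have := eventually_lt_nhds h
      exact ⟨this.mono fun s hs => (hL s hs).1, this.mono fun s hs => (hL s hs).2⟩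
    · right
      have := eventually_gt_nhds (show b < t by linarith)
      exact ⟨this.mono fun s hs => (hR s hs).1, this.mono fun s hs => (hR s hs).2⟩
  refine ⟨γ'', u'', fun t => ?_, fun t => ?_, ⟨min a b, fun t ht => ?_⟩,
      ⟨max (b + 1) (b' + (b + 1) - (a' - 1)), fun t ht => ?_⟩⟩
  · rcases hcase t with h | h
    · exact (hγ t).congr_of_eventuallyEq h.1
    · exact (hγ2 t).congr_of_eventuallyEq h.1
  · rcases hcase t with h | h
    · exact (hu t).congr h.1 h.2
    · exact ((hu' (r t)).comp c hrc.continuousAt).congr h.1 h.2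
  · have h1 := hL t (by have := min_le_right a b; linarith)
    rw [h1.1, h1.2]
    exact ha t (ht.trans (min_le_left _ _))
  · have h1 := hR t (by have := le_max_left (b + 1) (b' + (b + 1) - (a' - 1)); linarith)
    have h2 := hb' (r t)
        (by have := le_max_right (b + 1) (b' + (b + 1) - (a' - 1)); simp only [hr]; linarith)
    rw [h1.1, h1.2, Function.comp, h2.1, h2.2]
    exact ⟨rfl, add_comm _ _⟩

/-- Use the straight segment in the chart, run through by `Real.smoothTransition` so that it is
constant outside `[0, 1]`. -/
lemma PrimitiveAt.eventually_joined {f : M → ℝ} (hf : PrimitiveAt (n := n) θ f x) :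
    ∀ᶠ y in 𝓝 x, JoinedWithIntegral (n := n) θ x y (f y - f x) := by
  have hc : Filter.Tendsto (extChartAt (𝓡 n) x).symm (𝓝 (extChartAt (𝓡 n) x x)) (𝓝 x) := by
    have := (continuousAt_extChartAt_symm (I := 𝓡 n) x)
    rwa [ContinuousAt, extChartAt_to_inv] at this
  obtain ⟨r, hr, hB⟩ := Metric.eventually_nhds_iff_ball.1
    ((hc.eventually hf.eventually).and ((isOpen_target (n := n) x).mem_nhds
        (mem_extChartAt_target x)))
  set B := Metric.ball (extChartAt (𝓡 n) x x) r
  have h1 : ∀ᶠ y in 𝓝 x, extChartAt (𝓡 n) x y ∈ B :=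
    (continuousAt_extChartAt (I := 𝓡 n) x).eventually
        (Metric.isOpen_ball.mem_nhds (Metric.mem_ball_self hr))
  filter_upwards [h1, (isOpen_extChartAt_source (I := 𝓡 n) x).mem_nhds
      (mem_extChartAt_source (I := 𝓡 n) x)] with y hy hy'
  set c : ℝ → EuclideanSpace ℝ (Fin n) := fun t => extChartAt (𝓡 n) x x +
    Real.smoothTransition t • (extChartAt (𝓡 n) x y - extChartAt (𝓡 n) x x) with hcdef
  have hcs : ContDiff ℝ ∞ c :=
    contDiff_const.add (Real.smoothTransition.contDiff.smul contDiff_const)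
  have hcB : ∀ t, c t ∈ B := fun t =>
    (convex_ball (extChartAt (𝓡 n) x x) r).add_smul_sub_mem (Metric.mem_ball_self hr) hy
      ⟨Real.smoothTransition.nonneg t, Real.smoothTransition.le_one t⟩
  have hγ : ContMDiff 𝓘(ℝ, ℝ) (𝓡 n) ∞ ((extChartAt (𝓡 n) x).symm ∘ c) := fun t =>
    ((contMDiffOn_extChartAt_symm x).contMDiffAt ((isOpen_target (n := n) x).mem_nhds
        (hB _ (hcB t)).2)).comp t
      hcs.contMDiff.contMDiffAt
  refine ⟨(extChartAt (𝓡 n) x).symm ∘ c, fun t => f (((extChartAt (𝓡 n) x).symm ∘ c) t) - f x, hγ,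
      fun t g hg => ?_,
    ⟨0, fun t ht => ?_⟩, ⟨1, fun t ht => ?_⟩⟩
  · filter_upwards [hγ.continuous.continuousAt.eventually ((hB _ (hcB t)).1.sub_eventually_eq hg)]
        with s hs
    simp only [Function.comp] at hs ⊢
    linarith
  · have : c t = extChartAt (𝓡 n) x x := by simp [hcdef, Real.smoothTransition.zero_of_nonpos ht]
    simp only [Function.comp, this, extChartAt_to_inv, sub_self, and_self]
  · have : c t = extChartAt (𝓡 n) x y := by simp [hcdef, Real.smoothTransition.one_of_one_le ht]
    simp only [Function.comp, this, (extChartAt (𝓡 n) x).left_inv hy', and_self]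

lemma JoinedWithIntegral.exists_path (hθ : IsClosedForm (n := n) θ)
    (h : JoinedWithIntegral (n := n) θ x y c) :
    ∃ γ : Path x y, IsSmoothPath n γ ∧ lineIntegral θ γ = c := by
  obtain ⟨γ, u, hγ, hu, ⟨a, ha⟩, b, hb⟩ := h
  set r : ℝ → ℝ := fun t => min a b + t * (b - min a b) with hr
  have hrs : ContDiff ℝ ∞ r := by fun_prop
  have h0 : γ (r 0) = x ∧ u (r 0) = 0 := ha _ (by simp [hr])
  have h1 : γ (r 1) = y ∧ u (r 1) = c := hb _ (by simp [hr])
  set p : Path x y := ⟨⟨fun t => γ (r t), hγ.continuous.comp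
      (hrs.continuous.comp continuous_subtype_val)⟩, by simpa using h0.1, by simpa using h1.1⟩
      with hp
  have hext : ∀ t ∈ Icc (0 : ℝ) 1, p.extend t = γ (r t) := fun t ht => by
    rw [Path.extend_apply _ ht]; rfl
  have hsm : IsSmoothPath n p := by
    refine ContMDiffOn.congr (f := γ ∘ r) (hγ.comp hrs.contMDiff).contMDiffOn hext
  refine ⟨p, hsm, ?_⟩
  rw [lineIntegral_eq_sub hsm (u := u ∘ r), Function.comp, Function.comp, h1.2, h0.2, sub_zero]
  intro t ht
  obtain ⟨f, hf⟩ := closed_iff.1 hθ (p.extend t)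
  have h2 := (hf.hasDerivWithinAt hsm ht).add_const (u (r t) - f (γ (r t)))
  refine h2.congr_of_eventuallyEq_of_mem ?_ ht
  rw [hext t ht] at hf
  have h3 := hrs.continuous.continuousAt.eventually (hu (r t) f hf)
  filter_upwards [h3.filter_mono nhdsWithin_le_nhds, self_mem_nhdsWithin] with s hs hs'
  simp only [Function.comp, hext s hs']
  linarith

/-- A closed form on a connected manifold with vanishing integrals along the smooth loops at one
    base point is exact. -/
lemma IsClosedForm.isExactForm_of_lineIntegral_eq_zero [PreconnectedSpace M]
    (hθ : IsClosedForm (n := n) θ) (x₀ : M)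
    (h : ∀ γ : Path x₀ x₀, IsSmoothPath n γ → lineIntegral θ γ = 0) : IsExactForm (n := n) θ := by
  choose f hf using closed_iff.1 hθ
  have hj := fun x => (hf x).eventually_joined
  have hclopen : IsClopen {x | ∃ c, JoinedWithIntegral (n := n) θ x₀ x c} := by
    constructor
    · rw [← isOpen_compl_iff, isOpen_iff_mem_nhds]
      intro x hx
      filter_upwards [hj x] with y hy
      rintro ⟨c, hc⟩
      exact hx ⟨_, hc.trans hy.symm⟩
    · rw [isOpen_iff_mem_nhds]
      rintro x ⟨c, hc⟩
      filter_upwards [hj x] with y hy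
      exact ⟨_, hc.trans hy⟩
  have huniv := hclopen.eq_univ ⟨x₀, _, (hj x₀).self_of_nhds⟩
  have hall : ∀ x, ∃ c, JoinedWithIntegral (n := n) θ x₀ x c := fun x => by
    have := mem_univ x
    rwa [← huniv] at this
  choose F hF using hall
  -- Two curves from `x₀` to `x` close up to a smooth loop, whose integral vanishes by assumption;
  -- so `F` is the integral along any such curve.
  have huniq : ∀ x c, JoinedWithIntegral (n := n) θ x₀ x c → F x = c := by
    intro x c hc
    obtain ⟨γ, h1, h2⟩ := ((hF x).trans hc.symm).exists_path hθ
    rw [h γ h1] at h2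
    linarith
  refine exact_iff.2 ⟨F, fun x => ?_⟩
  have h1 := (hf x).add (PrimitiveAt.const (F x - f x x))
  simp only [add_zero] at h1
  refine h1.congr_fun ?_
  filter_upwards [hj x] with y hy
  rw [huniq y _ ((hF x).trans hy)]
  ring

end

/-! ### Critical points -/

section

section Critical

/-- Nondegeneracy says that the derivative of `df` in the chart is injective, hence antilipschitz in
finite dimension, so `df` cannot return to zero near `x`. -/
lemma HasNondegenerateHessianAt.isolated {θ : OneForm n M} {f : M → ℝ} {x : M}
    (hf : PrimitiveAt (n := n) θ f x) (h : HasNondegenerateHessianAt (n := n) f x) :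
    ∀ᶠ y in 𝓝[≠] x, θ y ≠ 0 := by
  set φ := extChartAt (𝓡 n) x with hφ
  set F := f ∘ φ.symm with hF
  have hc : Filter.Tendsto φ.symm (𝓝 (φ x)) (𝓝 x) := by
    have := (continuousAt_extChartAt_symm (I := 𝓡 n) x)
    rwa [ContinuousAt, extChartAt_to_inv] at this
  have hsm : ContDiffAt ℝ ∞ F (φ x) := by
    rw [← contMDiffAt_iff_contDiffAt]
    refine ContMDiffAt.comp (φ x) ?_ ((contMDiffOn_extChartAt_symm x).contMDiffAt
        ((isOpen_target (n := n) x).mem_nhds (mem_extChartAt_target x)))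
    rw [hφ, extChartAt_to_inv]
    exact hf.self_of_nhds.1
  have hd : HasFDerivAt (fderiv ℝ F) (fderiv ℝ (fderiv ℝ F) (φ x)) (φ x) :=
    ((hsm.fderiv_right (m := ∞) (by simp)).differentiableAt (by simp)).hasFDerivAt
  have hinj : LinearMap.ker (fderiv ℝ (fderiv ℝ F) (φ x)).toLinearMap = ⊥ := by
    rw [LinearMap.ker_eq_bot']
    intro u hu
    exact h u fun w => by
      have := congrArg (fun L : EuclideanSpace ℝ (Fin n) →L[ℝ] ℝ => L w) hu
      simpa using! this
  obtain ⟨C, -, hC⟩ := LinearMap.exists_antilipschitzWith _ hinj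
  have h1 := hd.eventually_ne (c := 0) ⟨C, hC⟩
  rw [eventually_nhdsWithin_iff] at h1 ⊢
  have h2 : Filter.Tendsto φ (𝓝 x) (𝓝 (φ x)) := continuousAt_extChartAt (I := 𝓡 n) x
  filter_upwards [h2.eventually h1, h2.eventually (hc.eventually hf),
      h2.eventually ((isOpen_target (n := n) x).mem_nhds (mem_extChartAt_target x)),
    (isOpen_extChartAt_source (I := 𝓡 n) x).mem_nhds (mem_extChartAt_source (I := 𝓡 n) x)] with y
        h3 h4 h5 h6 hyx h0
  refine h3 (fun he => hyx (φ.injOn h6 (mem_extChartAt_source x) he)) ?_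
  rw [hF, ← inChart_eq_fderiv h5 h4.1 h4.2, inChart, ← hφ]
  have hl : φ.symm (φ y) = y := φ.left_inv h6
  have h7 : ∀ z, z = y → ∀ u : EuclideanSpace ℝ (Fin n), θ z u = 0 := by
    rintro z rfl u; rw [h0]; rfl
  ext w
  exact h7 _ hl _

lemma isClosed_criticalSet (θ : OneForm n M) : IsClosed (criticalSet (n := n) θ) := by
  rw [← isOpen_compl_iff, isOpen_iff_mem_nhds]
  intro x hx
  have h1 := (contMDiffAt_oneForm_iff (α := θ) (x₀ := x)).1 θ.contMDiff.contMDiffAt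
  have h2 : (θ x).comp
      ((trivializationAt (EuclideanSpace ℝ (Fin n)) (TangentSpace (𝓡 n) : M → Type) x).symmL ℝ x) ≠
      0 := by
    intro h
    apply hx
    have hm : x ∈ (trivializationAt (EuclideanSpace ℝ (Fin n)) (TangentSpace (𝓡 n) : M → Type)
        x).baseSet :=
      FiberBundle.mem_baseSet_trivializationAt' x
    ext w
    have := congrArg (fun L : EuclideanSpace ℝ (Fin n) →L[ℝ] ℝ =>
        L ((trivializationAt (EuclideanSpace ℝ (Fin n)) (TangentSpace (𝓡 n) : M → Type)
        x).continuousLinearMapAt ℝ x w)) h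
    simp only [ContinuousLinearMap.comp_apply, Trivialization.symmL_continuousLinearMapAt _ hm]
        at this
    exact this
  filter_upwards [h1.continuousAt.eventually_ne h2] with y hy h0
  apply hy
  rw [show θ y = 0 from h0]
  rfl

lemma IsMorseForm.finite_criticalSet [CompactSpace M] {θ : OneForm n M}
    (h : IsMorseForm (n := n) θ) :
    (criticalSet (n := n) θ).Finite := by
  refine (isClosed_criticalSet θ).isCompact.finite ?_
  rw [isDiscrete_iff_nhdsNE]
  intro x hx
  obtain ⟨U, hU, hxU, f, hf, hd, hess⟩ := h.2 x
  have h1 : PrimitiveAt (n := n) θ f x := primitiveAt_iff.2 ⟨U, hU, hxU, hf, hd⟩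
  have h2 := (hess x hxU ((hd x hxU).symm.trans hx)).isolated h1
  exact (Filter.disjoint_principal_right.2 h2).eq_bot

/-- A closed form can be modified by an exact form so as to vanish near a finite set. -/
lemma IsClosedForm.exists_primitive_near [T2Space M] {η : OneForm n M}
    (hη : IsClosedForm (n := n) η)
    {K : Set M} (hK : K.Finite) :
    ∃ F : M → ℝ, ContMDiff (𝓡 n) 𝓘(ℝ, ℝ) ∞ F ∧ ∀ x ∈ K, PrimitiveAt (n := n) η F x := by
  induction K, hK using Set.Finite.induction_on with
  | empty => exact ⟨fun _ => 0, contMDiff_const, by simp⟩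
  | @insert p K hp hK ih =>
    obtain ⟨F, hF, hFK⟩ := ih
    obtain ⟨f, hf⟩ := closed_iff.1 hη p
    have hn : ({y | PrimitiveAt (n := n) η f y} ∩ Kᶜ) ∈ 𝓝 p :=
      Filter.inter_mem hf.eventually (hK.isClosed.isOpen_compl.mem_nhds hp)
    obtain ⟨χ, -, hχ⟩ := (SmoothBumpFunction.nhds_basis_tsupport (I := 𝓡 n) p).mem_iff.1 hn
    -- The cutoff `χ` is 1 near `p`, its support misses `K`, where `F` is kept, and on that support
    -- `f` is smooth.
    refine ⟨fun y => F y + χ y * (f y - F y), fun y => ?_, ?_⟩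
    · by_cases hy : y ∈ tsupport χ
      · exact (hF y).add ((χ.contMDiff y).mul (((hχ hy).1.self_of_nhds.1).sub (hF y)))
      · refine (hF y).congr_of_eventuallyEq ?_
        filter_upwards [notMem_tsupport_iff_eventuallyEq.1 hy] with z hz
        simp [hz]
    · rintro y (rfl | hy)
      · refine hf.congr_fun ?_
        filter_upwards [χ.eventuallyEq_one] with z hz
        simp [hz]
      · refine (hFK y hy).congr_fun ?_
        have : y ∉ tsupport χ := fun h => (hχ h).2 hy
        filter_upwards [notMem_tsupport_iff_eventuallyEq.1 this] with z hz
        simp [hz]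

end Critical

end

/-! ### Change of the Riemannian metric -/

section

lemma isBounded_sublevel {V : Type*} [NormedAddCommGroup V] [NormedSpace ℝ V]
    [FiniteDimensional ℝ V]
    (B : V →L[ℝ] V →L[ℝ] ℝ) (hB : ∀ v, v ≠ 0 → 0 < B v v) : Bornology.IsBounded {v | B v v < 1} :=
        by
  have hc : Continuous fun v => B v v := by fun_prop
  obtain ⟨m, hm, hmB⟩ := (isCompact_sphere (0 : V) 1).exists_forall_le' hc.continuousOn (a := 0)
    (fun v hv => hB v (by rintro rfl; simp at hv))
  refine (Metric.isBounded_iff_subset_closedBall 0).2 ⟨Real.sqrt (1 / m), fun v hv => ?_⟩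
  rw [mem_closedBall_zero_iff]
  rcases eq_or_ne v 0 with rfl | h0
  · simp
  have hn : 0 < ‖v‖ := norm_pos_iff.2 h0
  have h1 := hmB (‖v‖⁻¹ • v) (by simp [norm_smul, hn.ne'])
  simp only [map_smul, smul_apply, smul_eq_mul] at h1
  have hv : B v v < 1 := hv
  refine Real.le_sqrt_of_sq_le ?_
  rw [le_div_iff₀ hm]
  have h2 : m * ‖v‖ ^ 2 ≤ B v v := by
    calc m * ‖v‖ ^ 2 ≤ (‖v‖⁻¹ * (‖v‖⁻¹ * B v v)) * ‖v‖ ^ 2 := by gcongr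
      _ = B v v := by field_simp
  nlinarith

lemma contMDiffAt_smulRight {V W : Type*} [NormedAddCommGroup V] [NormedSpace ℝ V]
    [NormedAddCommGroup W] [NormedSpace ℝ W]
    {a : M → V →L[ℝ] ℝ} {b : M → W} {x : M} (ha : ContMDiffAt (𝓡 n) 𝓘(ℝ, V →L[ℝ] ℝ) ∞ a x)
    (hb : ContMDiffAt (𝓡 n) 𝓘(ℝ, W) ∞ b x) :
    ContMDiffAt (𝓡 n) 𝓘(ℝ, V →L[ℝ] W) ∞ (fun y => (a y).smulRight (b y)) x := by
  have h : ContDiff ℝ ∞ (fun p : (V →L[ℝ] ℝ) × W => p.1.smulRight p.2) := contDiff_fst.smulRight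
      contDiff_snd
  exact h.contMDiff.contMDiffAt.comp x (ha.prodMk_space hb)

/-- The tensor product of two 1-forms. -/
def tensor (α β : ∀ x : M, TangentSpace (𝓡 n) x →L[ℝ] ℝ) (x : M) : TangentSpace (𝓡 n) x →L[ℝ]
    TangentSpace (𝓡 n) x →L[ℝ] ℝ :=
  (α x).smulRight (β x)

lemma contMDiffAt_tensor {α β : ∀ x : M, TangentSpace (𝓡 n) x →L[ℝ] ℝ} {x₀ : M}
    (hα : ContMDiffAt (𝓡 n) ((𝓡 n).prod 𝓘(ℝ, EuclideanSpace ℝ (Fin n) →L[ℝ] ℝ)) ∞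
      (fun x => TotalSpace.mk' (EuclideanSpace ℝ (Fin n) →L[ℝ] ℝ)
        (E := fun x : M => TangentSpace (𝓡 n) x →L[ℝ] Bundle.Trivial M ℝ x) x (α x)) x₀)
    (hβ : ContMDiffAt (𝓡 n) ((𝓡 n).prod 𝓘(ℝ, EuclideanSpace ℝ (Fin n) →L[ℝ] ℝ)) ∞
      (fun x => TotalSpace.mk' (EuclideanSpace ℝ (Fin n) →L[ℝ] ℝ)
        (E := fun x : M => TangentSpace (𝓡 n) x →L[ℝ] Bundle.Trivial M ℝ x) x (β x)) x₀) :
    ContMDiffAt (𝓡 n) ((𝓡 n).prod 𝓘(ℝ, EuclideanSpace ℝ (Fin n) →L[ℝ] EuclideanSpace ℝ (Fin n)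
        →L[ℝ] ℝ)) ∞
      (fun x => TotalSpace.mk' (EuclideanSpace ℝ (Fin n) →L[ℝ] EuclideanSpace ℝ (Fin n) →L[ℝ] ℝ)
        (E := fun x : M => TangentSpace (𝓡 n) x →L[ℝ] TangentSpace (𝓡 n) x →L[ℝ] Bundle.Trivial M ℝ
            x) x (tensor α β x)) x₀ := by
  rw [contMDiffAt_oneForm_iff] at hα hβ
  rw [contMDiffAt_section]
  have hs : ContMDiffAt (𝓡 n) 𝓘(ℝ, EuclideanSpace ℝ (Fin n) →L[ℝ] EuclideanSpace ℝ (Fin n) →L[ℝ] ℝ)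
      ∞
      (fun x => ContinuousLinearMap.smulRight ((α x).comp
          ((trivializationAt (EuclideanSpace ℝ (Fin n))
        (TangentSpace (𝓡 n) : M → Type) x₀).symmL ℝ x))
            ((β x).comp ((trivializationAt (EuclideanSpace ℝ (Fin n))
        (TangentSpace (𝓡 n) : M → Type) x₀).symmL ℝ x))) x₀ := by
    exact contMDiffAt_smulRight hα hβ
  refine hs.congr_of_eventuallyEq ?_
  have hm : ∀ᶠ x in 𝓝 x₀, x ∈ (trivializationAt (EuclideanSpace ℝ (Fin n)) (TangentSpace (𝓡 n) :
      M → Type) x₀).baseSet :=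
    (trivializationAt (EuclideanSpace ℝ (Fin n)) (TangentSpace (𝓡 n) : M → Type)
        x₀).open_baseSet.mem_nhds (FiberBundle.mem_baseSet_trivializationAt' x₀)
  filter_upwards [hm] with x hx
  ext u w
  rw [hom_trivializationAt_apply]
  dsimp only
  rw [inCoordinates_apply_eq₂ hx hx (by simp)]
  simp only [tensor]
  simp [Trivialization.symmL_apply _ hx]

lemma contMDiff_pairing (α : OneForm n M) (v : SmoothVectorField n M) :
    ContMDiff (𝓡 n) 𝓘(ℝ, ℝ) ∞ fun x => (α x (v x) : ℝ) := by
  intro x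
  have h := α.contMDiff.contMDiffAt.clm_bundle_apply (E₁ := (TangentSpace (𝓡 n) : M → Type))
      (v := v) (v.contMDiff x)
  exact (contMDiffAt_totalSpace.1 h).2

section Metric

variable {θ θ' : OneForm n M} {v : SmoothVectorField n M}

/-- The bilinear form `(X, Y) ↦ g (P X, P Y) + θ' X * θ' Y / θ' v`, where `P X = X - (θ' X / θ' v)
    v`
and `θ = g(·, v)`. -/
def modifiedMetric (g : RiemannianMetric n M) (θ θ' : OneForm n M) (v : SmoothVectorField n M)
    (x : M) :
    TangentSpace (𝓡 n) x →L[ℝ] TangentSpace (𝓡 n) x →L[ℝ] ℝ :=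
  g.inner x - (θ' x (v x))⁻¹ • (tensor θ θ' x + tensor θ' θ x) +
    (((θ' x (v x))⁻¹) ^ 2 * θ x (v x) + (θ' x (v x))⁻¹) • tensor θ' θ' x

lemma modifiedMetric_apply (g : RiemannianMetric n M) (x : M) (X Y : TangentSpace (𝓡 n) x) :
    modifiedMetric g θ θ' v x X Y = g.inner x X Y - (θ' x (v x))⁻¹ * (θ x X * θ' x Y + θ' x X * θ x
        Y) +
    (((θ' x (v x))⁻¹) ^ 2 * θ x (v x) + (θ' x (v x))⁻¹) * (θ' x X * θ' x Y) := rfl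

/-- The correction terms cancel; at zeros of `θ (v)` they vanish because `0⁻¹ = 0`. So the new
metric is the old one near the critical points, where division by `θ' v` would fail. -/
lemma modifiedMetric_of_eq (g : RiemannianMetric n M) {x : M} (h : θ' x = θ x) :
    modifiedMetric g θ θ' v x = g.inner x := by
  ext X Y
  rw [modifiedMetric_apply, h]
  rcases eq_or_ne (θ x (v x)) 0 with h0 | h0
  · simp [h0]
  · field_simp
    ring

set_option synthInstance.maxHeartbeats 200000 in
set_option maxHeartbeats 1000000 in
lemma contMDiff_modifiedMetric (g : RiemannianMetric n M) {U : Set M} (hU : IsOpen U)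
    (hθU : criticalSet (n := n) θ ⊆ U) (hUθ : ∀ x ∈ U, θ' x = θ x)
    (hpos : ∀ x, θ x ≠ 0 → 0 < θ' x (v x)) :
    ContMDiff (𝓡 n) ((𝓡 n).prod 𝓘(ℝ, EuclideanSpace ℝ (Fin n) →L[ℝ] EuclideanSpace ℝ (Fin n) →L[ℝ]
        ℝ)) ∞
      (fun x => TotalSpace.mk' (EuclideanSpace ℝ (Fin n) →L[ℝ] EuclideanSpace ℝ (Fin n) →L[ℝ] ℝ)
        (E := fun x : M => TangentSpace (𝓡 n) x →L[ℝ] TangentSpace (𝓡 n) x →L[ℝ] Bundle.Trivial M ℝ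
            x) x (modifiedMetric g θ θ' v x)) := by
  intro x
  by_cases hx : x ∈ U
  · refine (g.contMDiff x).congr_of_eventuallyEq ?_
    filter_upwards [hU.mem_nhds hx] with y hy
    rw [modifiedMetric_of_eq g (hUθ y hy)]
  · have hne : θ' x (v x) ≠ 0 := (hpos x fun h => hx (hθU h)).ne'
    have h1 : ContMDiffAt (𝓡 n) 𝓘(ℝ, ℝ) ∞ (fun x => (θ' x (v x) : ℝ)⁻¹) x :=
      (contMDiff_pairing θ' v x).inv₀ hne
    have h2 := contMDiff_pairing θ v x
    have t1 := contMDiffAt_tensor (θ.contMDiff x) (θ'.contMDiff x)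
    have t2 := contMDiffAt_tensor (θ'.contMDiff x) (θ.contMDiff x)
    have t3 := contMDiffAt_tensor (θ'.contMDiff x) (θ'.contMDiff x)
    let V : M → Type := fun x : M => TangentSpace (𝓡 n) x →L[ℝ] TangentSpace (𝓡 n) x →L[ℝ]
        Bundle.Trivial M ℝ x
    have a1 := ContMDiffAt.add_section (V := V) t1 t2
    have a2 := ContMDiffAt.smul_section (V := V) h1 a1
    have a3 := ContMDiffAt.sub_section (V := V) (g.contMDiff x) a2
    have a4 := ContMDiffAt.smul_section (V := V) (((h1.pow 2).mul h2).add h1) t3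
    exact ContMDiffAt.add_section (V := V) a3 a4

/-- Off the zeros, `P` projects along `v` onto `ker θ'`. Since `P v = 0`, pairing with `v` leaves
exactly `θ'`; and `g(PX, PX) + (θ' X)² / θ' v` is positive, as `P X = X` when `θ' X = 0`. -/
lemma IsGradient.of_eq_near_criticalSet {g : RiemannianMetric n M}
    (hg : ∀ (x : M) (X : TangentSpace (𝓡 n) x), θ x X = g.inner x X (v x))
    {U : Set M} (hU : IsOpen U)
    (hθU : criticalSet (n := n) θ ⊆ U) (hUθ : ∀ x ∈ U, θ' x = θ x)
    (hpos : ∀ x, θ x ≠ 0 → 0 < θ' x (v x)) : IsGradient (n := n) θ' v := by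
  have hP : ∀ (x : M) (X : TangentSpace (𝓡 n) x), X ≠ 0 → 0 < modifiedMetric g θ θ' v x X X := by
    intro x X hX
    by_cases h : θ x = 0
    · rw [modifiedMetric_of_eq g (hUθ x (hθU h))]
      exact g.pos x X hX
    · have hD := hpos x h
      have hnonneg : ∀ Z : TangentSpace (𝓡 n) x, 0 ≤ g.inner x Z Z := fun Z => by
        rcases eq_or_ne Z 0 with rfl | hZ
        · simp
        · exact (g.pos x Z hZ).le
      have e : modifiedMetric g θ θ' v x X X = g.inner x (X - ((θ' x (v x))⁻¹ * θ' x X) • v x)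
          (X - ((θ' x (v x))⁻¹ * θ' x X) • v x) + (θ' x (v x))⁻¹ * (θ' x X) ^ 2 := by
        rw [modifiedMetric_apply]
        simp only [map_sub, map_smul, sub_apply, smul_apply, smul_eq_mul]
        rw [g.symm x (v x) X, ← hg, ← hg]
        ring
      rw [e]
      rcases eq_or_ne (θ' x X) 0 with h0 | h0
      · simpa [h0] using g.pos x X hX
      · have := hnonneg (X - ((θ' x (v x))⁻¹ * θ' x X) • v x)
        have : 0 < (θ' x (v x))⁻¹ * (θ' x X) ^ 2 := by positivity
        linarith
  refine ⟨⟨modifiedMetric g θ θ' v, fun x X Y => ?_, hP, fun x => ?_, contMDiff_modifiedMetric g hU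
      hθU hUθ hpos⟩, fun x X => ?_⟩
  · rw [modifiedMetric_apply, modifiedMetric_apply, g.symm x X Y]
    ring
  · exact (NormedSpace.isVonNBounded_iff ℝ (E := EuclideanSpace ℝ (Fin n))).2
      (isBounded_sublevel (V := EuclideanSpace ℝ (Fin n)) (modifiedMetric g θ θ' v x) (hP x))
  · change θ' x X = modifiedMetric g θ θ' v x X (v x)
    by_cases h : θ x = 0
    · have h' := hUθ x (hθU h)
      rw [modifiedMetric_of_eq g h', ← hg, h']
    · have hD := (hpos x h).ne'
      rw [modifiedMetric_apply, ← hg]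
      field_simp
      ring

lemma pairing_pos {g : RiemannianMetric n M}
    (hg : ∀ (x : M) (X : TangentSpace (𝓡 n) x), θ x X = g.inner x X (v x)) {x : M} (h : θ x ≠ 0) :
    0 < θ x (v x) := by
  rw [hg]
  refine g.pos x _ fun h0 => h ?_
  ext X
  rw [hg, h0]
  simp

/-- On `U` the perturbation vanishes. On the compact complement `θ (v)` has a positive lower bound
`m` and `∑ |A l (v)|` is bounded by some `B`, so `δ = m / (|B| + 1)` works. -/
lemma exists_pairing_pos [CompactSpace M] {ι : Type*} [Fintype ι] (A : ι → OneForm n M)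
    {U : Set M} (hU : IsOpen U) (hθU : criticalSet (n := n) θ ⊆ U) (hUA : ∀ l, ∀ x ∈ U, A l x = 0)
    (hpos : ∀ x, θ x ≠ 0 → 0 < θ x (v x)) :
    ∃ δ > 0, ∀ a : ι → ℝ, (∀ l, |a l| < δ) → ∀ x, θ x ≠ 0 → 0 < (∑ l, a l • A l + θ) x (v x) := by
  have happ : ∀ (a : ι → ℝ) x, (∑ l, a l • A l + θ) x (v x) = ∑ l, a l * A l x (v x) + θ x (v x) :=
      by
    intro a x
    have h1 : (∑ l, a l • A l + θ) x = ∑ l, a l • A l x + θ x := by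
      rw [← sum_smul_apply]; rfl
    rw [h1]
    have hlin : ∀ (L : ι → EuclideanSpace ℝ (Fin n) →L[ℝ] ℝ) (L' : EuclideanSpace ℝ (Fin n) →L[ℝ] ℝ)
        (w : EuclideanSpace ℝ (Fin n)), (∑ l, a l • L l + L') w = ∑ l, a l * L l w + L' w := by
      intro L L' w
      simp
    exact hlin (fun l => A l x) (θ x) (v x)
  have hC : IsCompact Uᶜ := hU.isClosed_compl.isCompact
  obtain ⟨m, hm, hmq⟩ := hC.exists_forall_le' (contMDiff_pairing θ v).continuous.continuousOn
      (a := 0)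
    (fun x hx => hpos x fun h => hx (hθU h))
  obtain ⟨B, hB⟩ := hC.exists_bound_of_continuousOn (f := fun x => ∑ l, |A l x (v x)|)
    (continuous_finsetSum _ fun l _ => (contMDiff_pairing (A l) v).continuous.abs).continuousOn
  have hBp : 0 < |B| + 1 := by positivity
  refine ⟨m / (|B| + 1), by positivity, fun a ha x hx => ?_⟩
  rw [happ]
  by_cases hxU : x ∈ U
  · have : ∑ l, a l * A l x (v x) = 0 := Finset.sum_eq_zero fun l _ => by
      rw [hUA l x hxU]; exact mul_zero _
    rw [this, zero_add]
    exact hpos x hx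
  · have h1 := hmq x hxU
    have h2 := (le_abs_self _).trans (hB x hxU)
    have h3 : |∑ l, a l * A l x (v x)| ≤ m / (|B| + 1) * ∑ l, |A l x (v x)| := by
      rw [Finset.mul_sum]
      refine (Finset.abs_sum_le_sum_abs _ _).trans (Finset.sum_le_sum fun l _ => ?_)
      rw [abs_mul]
      exact mul_le_mul_of_nonneg_right (ha l).le (abs_nonneg _)
    have h4 : m / (|B| + 1) * ∑ l, |A l x (v x)| < m := by
      rw [div_mul_eq_mul_div, div_lt_iff₀ hBp]
      have := le_abs_self B
      exact mul_lt_mul_of_pos_left (by linarith) hm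
    have h5 := neg_abs_le (∑ l, a l * A l x (v x))
    linarith

end Metric

end

/-! ### Rational combinations and assembly of the new form -/

variable (n M) in
/-- The space of closed 1-forms. -/
def closedForms : Submodule ℝ (OneForm n M) where
  carrier := {θ | IsClosedForm (n := n) θ}
  add_mem' {α β} hα hβ := by
    refine closed_iff.2 fun x => ?_
    obtain ⟨f, hf⟩ := closed_iff.1 hα x
    obtain ⟨g, hg⟩ := closed_iff.1 hβ x
    exact ⟨_, hf.add hg⟩
  zero_mem' := closed_iff.2 fun x => ⟨_, PrimitiveAt.const 0⟩
  smul_mem' c α hα := by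
    refine closed_iff.2 fun x => ?_
    obtain ⟨f, hf⟩ := closed_iff.1 hα x
    exact ⟨_, hf.const_mul c⟩

variable (n M) in
/-- The space of exact 1-forms. -/
def exactForms : Submodule ℝ (OneForm n M) where
  carrier := {θ | IsExactForm (n := n) θ}
  add_mem' {α β} hα hβ := by
    obtain ⟨f, hf⟩ := exact_iff.1 hα
    obtain ⟨g, hg⟩ := exact_iff.1 hβ
    exact exact_iff.2 ⟨_, fun x => (hf x).add (hg x)⟩
  zero_mem' := exact_iff.2 ⟨_, fun x => PrimitiveAt.const 0⟩
  smul_mem' c α hα := by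
    obtain ⟨f, hf⟩ := exact_iff.1 hα
    exact exact_iff.2 ⟨_, fun x => (hf x).const_mul c⟩

lemma exactForms_le_closedForms : exactForms n M ≤ closedForms n M := fun θ hθ => by
  obtain ⟨f, hf⟩ := exact_iff.1 (show IsExactForm (n := n) θ from hθ)
  exact closed_iff.2 fun x => ⟨f, hf x⟩

/-- The differential of a smooth function. -/
def differential (F : M → ℝ) (hF : ContMDiff (𝓡 n) 𝓘(ℝ, ℝ) ∞ F) : OneForm n M :=
  ofPrimitives (mvfderiv (𝓡 n) F) fun _ => ⟨F, primitiveAt_of_contMDiff hF⟩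

lemma differential_mem (F : M → ℝ) (hF : ContMDiff (𝓡 n) 𝓘(ℝ, ℝ) ∞ F) : differential F hF ∈
    exactForms n M :=
  exact_iff.2 ⟨F, fun _ => primitiveAt_of_contMDiff hF⟩

/-- A subgroup inside `rℤ` has no element in `(0, r)`, hence is cyclic; a nonzero element makes it
infinite. -/
lemma nonempty_addEquiv_int {H : AddSubgroup ℝ} {r : ℝ} (hr : 0 < r) (h : ∀ c ∈ H, ∃ k : ℤ, c =
    k * r)
    (hne : ∃ c ∈ H, c ≠ 0) : Nonempty (H ≃+ ℤ) := by
  obtain ⟨b, hb⟩ := AddSubgroup.cyclic_of_isolated_zero (H := H) hr (by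
    rw [Set.disjoint_left]
    rintro c hc ⟨h0, h1⟩
    obtain ⟨k, rfl⟩ := h c hc
    have h2 : 0 < k := by
      by_contra hk
      have : (k : ℝ) ≤ 0 := by exact_mod_cast not_lt.1 hk
      nlinarith
    have h3 : (1 : ℝ) ≤ k := by exact_mod_cast h2
    nlinarith)
  rw [← AddSubgroup.zmultiples_eq_closure] at hb
  obtain ⟨c, hc, hc0⟩ := hne
  have hb0 : b ≠ 0 := by
    rintro rfl
    rw [hb] at hc
    simp at hc
    exact hc0 hc
  have hinj : Function.Injective (zmultiplesHom ℝ b) := fun i j hij => by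
    simpa [hb0] using hij
  have hr : (zmultiplesHom ℝ b).range = H := by rw [hb]; rfl
  exact ⟨((AddMonoidHom.ofInjective hinj).trans (AddEquiv.addSubgroupCongr hr)).symm⟩

/-- With `N` the product of the denominators, every period is an integer multiple of `1 / N`. If all
periods at `x₀` were zero, the form would be exact. -/
lemma isRational_of_integral_combination [PreconnectedSpace M] {ι : Type*} [Fintype ι]
    {A : ι → OneForm n M}
    (hA : ∀ i, IsIntegralForm (n := n) (A i)) (q : ι → ℚ) {ε : OneForm n M}
        (hε : IsExactForm (n := n) ε)
    (hc : IsClosedForm (n := n) (∑ i, (q i : ℝ) • A i + ε))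
        (hne : ¬ IsExactForm (n := n) (∑ i, (q i : ℝ) • A i + ε)) :
    IsRational (n := n) (∑ i, (q i : ℝ) • A i + ε) := by
  refine ⟨hc, fun x₀ => ?_⟩
  set N : ℕ := ∏ i, (q i).den
  have hN : 0 < N := Finset.prod_pos fun i _ => (q i).den_pos
  have hq : ∀ i, ∃ m : ℤ, (q i : ℝ) = m * (1 / N : ℝ) := by
    intro i
    obtain ⟨m, hm⟩ := Finset.dvd_prod_of_mem (fun i => (q i).den) (Finset.mem_univ i)
    refine ⟨(q i).num * m, ?_⟩
    have hN' : (N : ℝ) = (q i).den * m := by exact_mod_cast hm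
    have h1 : ((q i).den : ℝ) ≠ 0 := by exact_mod_cast (q i).den_pos.ne'
    have h2 : (m : ℝ) ≠ 0 := by
      rintro h
      rw [h, mul_zero] at hN'
      exact hN.ne' (by exact_mod_cast hN')
    rw [hN', Rat.cast_def]
    push_cast
    field_simp
  refine nonempty_addEquiv_int (r := 1 / N) (by positivity) (fun c hcmem => ?_) ?_
  · refine AddSubgroup.closure_induction (p := fun c _ => ∃ k : ℤ, c = k * (1 / N : ℝ)) ?_
        ⟨0, by simp⟩ ?_ ?_ hcmem
    · rintro c ⟨g, γ, hγ, -, rfl⟩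
      rw [lineIntegral_sum_smul_add _ _ _ _ hγ, hε.lineIntegral_eq_zero hγ]
      choose k hk using fun i => (hA i).lineIntegral_eq_int hγ
      choose m hm using hq
      refine ⟨∑ i, m i * k i, ?_⟩
      push_cast
      rw [add_zero, Finset.sum_mul]
      exact Finset.sum_congr rfl fun i _ => by rw [hm, hk]; ring
    · rintro _ _ _ _ ⟨k, rfl⟩ ⟨l, rfl⟩
      exact ⟨k + l, by push_cast; ring⟩
    · rintro _ _ ⟨k, rfl⟩
      exact ⟨-k, by push_cast; ring⟩
  · by_contra hall
    push Not at hall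
    refine hne (hc.isExactForm_of_lineIntegral_eq_zero x₀ fun γ hγ => hall _ ?_)
    exact AddSubgroup.subset_closure ⟨_, γ, hγ, rfl, rfl⟩

/-- Rational coefficients near given real ones, off a proper subspace. -/
lemma exists_rat_notMem {ι : Type*} [Fintype ι] {W : Submodule ℝ (ι → ℝ)} (hW : W ≠ ⊤) (b : ι → ℝ)
    {δ : ℝ} (hδ : 0 < δ) :
    ∃ q : ι → ℚ, (∀ i, |q i - b i| < δ) ∧ (fun i => (q i : ℝ)) ∉ W := by
  have hcl : IsClosed (W : Set (ι → ℝ)) := W.closed_of_finiteDimensional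
  -- A proper subspace has empty interior, so the ball minus `W` is a nonempty open set and contains
  -- a rational point.
  have hne : (Metric.ball b δ ∩ (W : Set (ι → ℝ))ᶜ).Nonempty := by
    by_contra h
    rw [not_nonempty_iff_eq_empty, ← disjoint_iff_inter_eq_empty, disjoint_compl_right_iff_subset]
        at h
    exact hW (W.eq_top_of_nonempty_interior' ⟨b, interior_mono h (by
      rw [Metric.isOpen_ball.interior_eq]; exact Metric.mem_ball_self hδ)⟩)
  have hd : DenseRange (Pi.map fun (_ : ι) (q : ℚ) => (q : ℝ)) := DenseRange.piMap
      fun _ => Rat.denseRange_cast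
  obtain ⟨q, hq⟩ := hd.exists_mem_open (Metric.isOpen_ball.inter hcl.isOpen_compl) hne
  refine ⟨q, fun i => ?_, hq.2⟩
  have := (dist_le_pi_dist _ _ i).trans_lt (Metric.mem_ball.1 hq.1)
  rwa [Real.dist_eq] at this

/-- Nondegeneracy matters only at the zeros: there the primitives of `θ` serve again, and elsewhere
a neighborhood free of zeros makes the condition vacuous. -/
lemma IsMorseForm.of_eq_near_criticalSet {θ θ' : OneForm n M} (hθ : IsMorseForm (n := n) θ)
    (hc : IsClosedForm (n := n) θ') (hcrit : criticalSet (n := n) θ' = criticalSet (n := n) θ)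
        {U : Set M} (hU : IsOpen U)
    (hθU : criticalSet (n := n) θ ⊆ U) (hUθ : ∀ x ∈ U, θ' x = θ x) : IsMorseForm (n := n) θ' := by
  refine ⟨hc, fun x => ?_⟩
  by_cases hx : x ∈ criticalSet (n := n) θ
  · obtain ⟨V, hV, hxV, f, hf, hd, hess⟩ := hθ.2 x
    exact ⟨V ∩ U, hV.inter hU, ⟨hxV, hθU hx⟩, f, hf.mono inter_subset_left,
      fun y hy => (hUθ y hy.2).trans (hd y hy.1), fun y hy => hess y hy.1⟩
  · obtain ⟨f, hf⟩ := closed_iff.1 hc x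
    obtain ⟨V, hV, hxV, hfV, hd⟩ := primitiveAt_iff.1 hf
    refine ⟨V ∩ (criticalSet (n := n) θ')ᶜ, hV.inter (isClosed_criticalSet θ').isOpen_compl,
        ⟨hxV, by rwa [hcrit]⟩, f,
      hfV.mono inter_subset_left, fun y hy => hd y hy.1,
          fun y hy h0 => absurd ((hd y hy.1).trans h0) hy.2⟩

lemma sum_elim_zero_smul {ι κ V : Type*} [Fintype ι] [Fintype κ] [AddCommGroup V] [Module ℝ V]
    (b : ι → ℝ)
    (A : ι → V) (B : κ → V) : ∑ i, Sum.elim b 0 i • Sum.elim A B i = ∑ i, b i • A i := by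
  simp

lemma comap_linearCombination_ne_top {ι V : Type*} [Fintype ι] [AddCommGroup V] [Module ℝ V]
    {S : Submodule ℝ V}
    {A : ι → V} {i : ι} (h : A i ∉ S) : S.comap (Fintype.linearCombination ℝ A) ≠ ⊤ := by
  classical
  intro htop
  have : Pi.single i (1 : ℝ) ∈ S.comap (Fintype.linearCombination ℝ A) := by rw [htop]; trivial
  rw [Submodule.mem_comap, Fintype.linearCombination_apply_single, one_smul] at this
  exact h this

/-- When the `D i` and `θ - ∑ b i • A i` are exact, the right side is exact, so the perturbed form
is cohomologous to `∑ q i • A i`. -/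
lemma combination_identity {ι V : Type*} [Fintype ι] [AddCommGroup V] [Module ℝ V] (q b : ι → ℝ)
    (A D : ι → V) (θ : V) :
    (∑ i, (q i - b i) • (A i - D i) + θ) - ∑ i, q i • A i = (θ - ∑ i, b i • A i) - ∑ i,
        (q i - b i) • D i := by
  simp only [smul_sub, sub_smul, Finset.sum_sub_distrib]
  abel

/-- A finite family of integral forms that spans the class of `θ` and contains a form that is not
    exact. -/
lemma exists_integral_family [T2Space M] [CompactSpace M] {η θ : OneForm n M}
    (hη : IsClosedForm (n := n) η)
    (hne : ¬ IsExactForm (n := n) η) (hθ : IsClosedForm (n := n) θ) :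
    ∃ (ι : Type) (_ : Fintype ι) (b : ι → ℝ) (A : ι → OneForm n M),
        (∀ i, IsIntegralForm (n := n) (A i)) ∧
      θ - ∑ i, b i • A i ∈ exactForms n M ∧ ∃ i, A i ∉ exactForms n M := by
  obtain ⟨d, b, α, ε, hα, hε, hdec⟩ := hθ.exists_integral_decomposition
  obtain ⟨d', b', α', ε', hα', hε', hdec'⟩ := hη.exists_integral_decomposition
  -- The forms from `η` enter with coefficient 0, only to supply one that is not exact.
  refine ⟨Fin d ⊕ Fin d', inferInstance, Sum.elim b 0, Sum.elim α α', ?_, ?_, ?_⟩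
  · rintro (i | i)
    exacts [hα i, hα' i]
  · have h0 : ∑ i, Sum.elim b 0 i • Sum.elim α α' i = ∑ i, b i • α i :=
      sum_elim_zero_smul (V := OneForm n M) b α α'
    rw [h0, hdec, add_sub_cancel_left]
    exact hε
  · by_contra hall
    push Not at hall
    apply hne
    change η ∈ exactForms n M
    rw [hdec']
    exact add_mem (sum_mem fun i _ => Submodule.smul_mem _ _ (hall (Sum.inr i))) hε'

end MorseForms
end

theorem lemma4p2 {n : ℕ} {M : Type*} [TopologicalSpace M] [T2Space M] [CompactSpace M]
    [ConnectedSpace M] [ChartedSpace (EuclideanSpace ℝ (Fin n)) M] [IsManifold (𝓡 n) ∞ M]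
    (hM : ∃ η : MorseForms.OneForm n M,
      MorseForms.IsClosedForm η ∧ ¬ MorseForms.IsExactForm η)
    (θ : MorseForms.OneForm n M) (hθ : MorseForms.IsMorseForm θ)
    (v : MorseForms.SmoothVectorField n M) (hv : MorseForms.IsGradient θ v) :
    ∃ θ' : MorseForms.OneForm n M,
      MorseForms.IsMorseForm θ' ∧ MorseForms.IsRational θ' ∧
      MorseForms.criticalSet θ' = MorseForms.criticalSet θ ∧
      (∃ U : Set M, IsOpen U ∧ MorseForms.criticalSet θ ⊆ U ∧ ∀ x ∈ U, θ' x = θ x) ∧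
      MorseForms.IsGradient θ' v := by
  open MorseForms in
  obtain ⟨η, hη, hηne⟩ := hM
  obtain ⟨g, hg⟩ := hv
  obtain ⟨ι, _, b, A, hA, hθA, i₀, hi₀⟩ := exists_integral_family hη hηne hθ.1
  choose F hF hFK using fun i => (hA i).isClosedForm.exists_primitive_near hθ.finite_criticalSet
  set D : ι → OneForm n M := fun i => differential (F i) (hF i) with hD
  have hzero : ∀ x ∈ criticalSet (n := n) θ, ∀ᶠ y in nhds x, ∀ i, (A i - D i) y = 0 := by
    intro x hx
    rw [Filter.eventually_all]
    intro i
    filter_upwards [hFK i x hx] with y hy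
    have h1 : (A i - D i) y = A i y - mvfderiv (𝓡 n) (F i) y := rfl
    rw [h1, hy.2, sub_self]
  set U := interior {y | ∀ i, (A i - D i) y = 0} with hUdef
  have hU : IsOpen U := isOpen_interior
  have hθU : criticalSet (n := n) θ ⊆ U := fun x hx => mem_interior_iff_mem_nhds.2 (hzero x hx)
  obtain ⟨δ, hδ, hpos⟩ := exists_pairing_pos (θ := θ) (v := v) (fun i => A i - D i) hU hθU
    (fun i x hx => interior_subset hx i) (fun x hx => pairing_pos hg hx)
  obtain ⟨q, hqb, hq⟩ := exists_rat_notMem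
    (comap_linearCombination_ne_top (S := exactForms n M) hi₀) b hδ
  -- The coefficients are small, which keeps `θ' (v)` positive, and move the class from `b` to `q`;
  -- the forms `A i - D i` vanish on `U`, which keeps `θ` there.
  set θ' : OneForm n M := ∑ i, ((q i : ℝ) - b i) • (A i - D i) + θ with hθ'
  have hε : θ' - ∑ i, (q i : ℝ) • A i ∈ exactForms n M := by
    have : θ' - ∑ i, (q i : ℝ) • A i = (θ - ∑ i, b i • A i) - ∑ i, ((q i : ℝ) - b i) • D i := by
      exact combination_identity (V := OneForm n M) _ b A D θ
    rw [this]
    exact sub_mem hθA (sum_mem fun i _ => Submodule.smul_mem _ _ (differential_mem _ _))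
  set ε := θ' - ∑ i, (q i : ℝ) • A i with hεdef
  have hθ'ε : θ' = ∑ i, (q i : ℝ) • A i + ε := by rw [hεdef]; abel
  have hcl : IsClosedForm (n := n) θ' := by
    change θ' ∈ closedForms n M
    rw [hθ'ε]
    exact add_mem (sum_mem fun i _ => Submodule.smul_mem _ _ (hA i).isClosedForm)
        (exactForms_le_closedForms hε)
  have hne : ¬ IsExactForm (n := n) θ' := by
    intro h
    apply hq
    rw [Submodule.mem_comap, Fintype.linearCombination_apply]
    have : ∑ i, (q i : ℝ) • A i = θ' - ε := by rw [hεdef]; abel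
    rw [this]
    exact sub_mem (show θ' ∈ exactForms n M from h) hε
  have hUθ : ∀ x ∈ U, θ' x = θ x := by
    intro x hx
    have h1 : θ' x = ∑ i, ((q i : ℝ) - b i) • (A i - D i) x + θ x := by
      rw [← sum_smul_apply]; rfl
    have h2 : ∑ i, ((q i : ℝ) - b i) • (A i - D i) x = 0 :=
      Finset.sum_eq_zero fun i _ => by rw [interior_subset hx i, smul_zero]
    rw [h1, h2, zero_add]
  have hpos' := hpos (fun i => (q i : ℝ) - b i) hqb
  have hcrit : criticalSet (n := n) θ' = criticalSet (n := n) θ := by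
    ext x
    refine ⟨fun h => ?_, fun h => (hUθ x (hθU h)).trans h⟩
    by_contra h0
    have h1 := hpos' x h0
    rw [← hθ', show θ' x = 0 from h] at h1
    exact lt_irrefl _ h1
  refine ⟨θ', hθ.of_eq_near_criticalSet hcl hcrit hU hθU hUθ, ?_, hcrit, ⟨U, hU, hθU, hUθ⟩,
    IsGradient.of_eq_near_criticalSet hg hU hθU hUθ hpos'⟩
  rw [hθ'ε] at hcl hne ⊢
  exact isRational_of_integral_combination hA q hε hcl hne
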